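/- **Proposition (Scaling of the Confidence Radius).** For Borel probability measures $\mu,\nu$ on a closed set $\Xi\subset\mathbb{R}^m$ let $\Gamma(\mu,\nu)$ be the set of their couplings, and put $W_1(\mu,\nu)=\inf_{\gamma\in\Gamma(\mu,\nu)}\mathbb{E}_\gamma\|\xi-\zeta\|$ and $W_\infty(\mu,\nu)=\inf_{\gamma\in\Gamma(\mu,\nu)}\operatorname{ess\,sup}_{\gamma}\|\xi-\zeta\|$, where $\|\cdot\|$ is the Euclidean norm. Let $\mathcal{W}_T$ be the set of non-negative $w\in\mathbb{R}^T$ with $\sum_{t=1}^T w_t=1$; for $w\in\mathcal{W}_T$ let $T_{\mathrm{eff}}(w)=1/\sum_{t=1}^T w_t^2$ and $D_1(w)=\sum_{t=1}^T w_t(T-t+1)$. Call $w\in\mathcal{W}_T$ *optimal* for the drift bound $\rho$ and the radius $\varepsilon$ if it maximizes $T_{\mathrm{eff}}(w)\,\bigl(\varepsilon-D_1(w)\rho\bigr)_+^{2}$ over $\mathcal{W}_T$. Let $m\in\mathbb{N}$, let $q\in(0,1/2)$ with $qm\le 1$, and let $\Delta\in\mathbb{R}$. There are constants $c_1,c_2>0$,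 depending only on $m,q,\Delta$, such that for every $\beta_0\in(0,1]$ there are constants $c_3>0$ and $c_4\ge 0$, depending only on $m,q,\Delta,\beta_0$, with $c_4=0$ if $\beta_0<1$, for which the following holds. For every closed bounded $\Xi\subset\mathbb{R}^m$ with $\operatorname{diam}(\Xi)\le\Delta$, every $\beta\in(0,\beta_0)$, every $\rho>0$ and every $T\in\mathbb{N}$ with $T\ge\bigl(\tfrac{12}{c_2}\rho^{-2}\log(1/\beta)\bigr)^{1/3}$, put $\rho_\star(\beta)=\bigl(\tfrac{12}{c_2}\log(1/\beta)\bigr)^{1/2}$ and \[ \varepsilon(\beta,\rho)= \begin{cases} c_1\bigl(\rho\log(1/\beta)\bigr)^{1/3}+c_2\bigl(\rho^{2q}\log(1/\beta)^{-q}\bigr)^{1/3} & \text{if }\rho<\rho_\star(\beta),\\ \rho+c_3\log(1/\beta)^{1/2}+c_4 & \text{if }\rho\ge\rho_\star(\beta). \end{cases} \] Then an optimal weighting $w\in\mathcal{W}_T$ for $\rho$ and $\varepsilon(\beta,\rho)$ exists, and every such $w$ is the triangular weighting \[ w_t=\frac{\bigl(\varepsilon(\beta,\rho)-\rho(T-t+1)\bigr)_+}{\sum_{s=1}^T\bigl(\varepsilon(\beta,\rho)-\rho(T-s+1)\bigr)_+},\qquad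 t=1,\dots,T. \] Moreover, for this $w$, for all Borel probability measures $\mathbb{P}_1,\dots,\mathbb{P}_{T+1}$ on $\Xi$ with $W_\infty(\mathbb{P}_t,\mathbb{P}_{t+1})\le\rho$ for $t=1,\dots,T$, and for all independent random vectors $\boldsymbol\xi_t\sim\mathbb{P}_t$, $t=1,\dots,T$, \[ \Pr\Bigl[W_1\Bigl(\sum_{t=1}^T w_t\,\delta_{\boldsymbol\xi_t},\,\mathbb{P}_{T+1}\Bigr)\ge\varepsilon(\beta,\rho)\Bigr]\le\beta . \] In particular, the smallest radius at which some weighting attains confidence $1-\beta$ is at most $\varepsilon(\beta,\rho)$. -/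

import Mathlib

open MeasureTheory ProbabilityTheory
open scoped ENNReal

noncomputable section

/-- `γ` is a coupling of the probability measures `μ` and `ν`. -/
def IsCoupling {X : Type*} [MeasurableSpace X] (μ ν : Measure X) (γ : Measure (X × X)) : Prop :=
  γ.map Prod.fst = μ ∧ γ.map Prod.snd = ν

/-- The `p`-Wasserstein distance `(inf_γ E_γ[d(x, y)^p])^(1/p)`, with values in `[0, ∞]`. -/
def wassersteinDist {X : Type*} [PseudoEMetricSpace X] [MeasurableSpace X]
    (p : ℝ) (μ ν : Measure X) : ℝ≥0∞ :=
  (⨅ γ : {γ : Measure (X × X) // IsCoupling μ ν γ}, ∫⁻ z, edist z.1 z.2 ^ p ∂γ.1) ^ (1 / p)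

/-- The `∞`-Wasserstein distance `inf_γ esssup_γ d(x, y)`, with values in `[0, ∞]`. -/
def wassersteinInfDist {X : Type*} [PseudoEMetricSpace X] [MeasurableSpace X]
    (μ ν : Measure X) : ℝ≥0∞ :=
  ⨅ γ : {γ : Measure (X × X) // IsCoupling μ ν γ},
    essSup (fun z : X × X => edist z.1 z.2) γ.1

/-- The weighted empirical distribution `∑ₜ wₜ δ_{xₜ}`. -/
def weightedEmpirical {X : Type*} [MeasurableSpace X] {T : ℕ} (w : Fin T → ℝ) (x : Fin T → X) :
    Measure X :=
  ∑ t, ENNReal.ofReal (w t) • Measure.dirac (x t)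

/-- The effective sample size `1 / ∑ₜ wₜ²`. -/
def effectiveSampleSize {T : ℕ} (w : Fin T → ℝ) : ℝ :=
  1 / ∑ t, w t ^ 2

/-- The look-back index `T - t + 1` of the time `t ∈ {1, …, T}`. The element `t : Fin T`, counted
from `0`, stands for the time `t + 1`, so that the look-back index is `T - t` here. -/
def lookBack {T : ℕ} (t : Fin T) : ℝ :=
  (T : ℝ) - (t : ℕ)

/-- The normalized weighted drift `(∑ₜ wₜ (T - t + 1)^p)^(1/p)`. -/
def weightedDrift {T : ℕ} (p : ℝ) (w : Fin T → ℝ) : ℝ :=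
  (∑ t, w t * lookBack t ^ p) ^ (1 / p)

/-- `w` is an optimal weighting for the order `p`, the drift bound `ρ` and the radius `ε`: it
maximizes `T_eff(w) (ε - D_p(w) ρ)₊^(2p)` over the probability simplex. -/
def IsOptimalWeighting {T : ℕ} (p ρ ε : ℝ) (w : Fin T → ℝ) : Prop :=
  w ∈ stdSimplex ℝ (Fin T) ∧
    IsMaxOn (fun v : Fin T → ℝ =>
      effectiveSampleSize v * max 0 (ε - weightedDrift p v * ρ) ^ (2 * p))
      (stdSimplex ℝ (Fin T)) w

/-- The triangular weights `wₜ = (ε - ρ (T - t + 1))₊ / ∑ₛ (ε - ρ (T - s + 1))₊`. -/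
def triangularWeights (T : ℕ) (ρ ε : ℝ) (t : Fin T) : ℝ :=
  max 0 (ε - ρ * lookBack t) / ∑ s : Fin T, max 0 (ε - ρ * lookBack s)

/-- The drift threshold `(12 / c₂ · log (1/β))^(1/2)`. -/
def driftThreshold (c₂ β : ℝ) : ℝ :=
  (12 / c₂ * Real.log (1 / β)) ^ (1 / 2 : ℝ)

open Classical in
/-- The confidence radius `ε(β, ρ)`, with an additive constant `c₄` in the large-drift regime. -/
def confidenceRadius (c₁ c₂ c₃ c₄ q β ρ : ℝ) : ℝ :=
  if ρ < driftThreshold c₂ β then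
    c₁ * (ρ * Real.log (1 / β)) ^ (1 / 3 : ℝ) +
      c₂ * (ρ ^ (2 * q) * Real.log (1 / β) ^ (-q)) ^ (1 / 3 : ℝ)
  else
    ρ + c₃ * Real.log (1 / β) ^ (1 / 2 : ℝ) + c₄

end

/-!
The proof rests on three facts.

*Optimality.* On the simplex, `ε - D₁(w) ρ = ∑ₜ wₜ (ε - ρ (T - t + 1)) ≤ ∑ₜ wₜ (ε - ρ (T - t + 1))₊`,
so by the Cauchy–Schwarz inequality the objective is at most `∑ₜ (ε - ρ (T - t + 1))₊²`, and it
attains this value exactly at the triangular weighting as soon as `ρ < ε`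
(`isOptimalWeighting_triangularWeights`, `IsOptimalWeighting.eq_triangularWeights`).

*Deviation.* For independent samples `xₜ ∼ Pₜ` the distance of `∑ₜ wₜ δ_{xₜ}` from the mixture
`∑ₜ wₜ Pₜ` is at most the cost of a greedy coupling along dyadic cells
(`exists_multiscale_coupling`). This cost is a measurable function of the sample with bounded
differences proportional to `wₜ`, hence concentrates around its mean at the scale `T_eff ^ (-1/2)`
(`measure_pi_ge_le_of_bounded_differences`). Its mean is of order `T_eff ^ (-q)`: the discrepancy on
each level is bounded by a second moment (`integral_partitionDiscrepancy_le`), and the finest level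
is chosen in terms of `T_eff` (`exists_level_bound`). Working with this upper bound avoids both the
measurability of the Wasserstein distance and Kantorovich duality.

*Drift.* Gluing of couplings yields the triangle inequality, so that the mixture is within
`D₁(w) ρ` of the last law (`wassersteinDist_one_mixture_last_le`).

In the small-drift regime, with `N = (12 / c₂ · ρ⁻² log (1/β)) ^ (1/3) > 1`, the radius is
`c₁ K N ρ + c₂ K ^ (-q) N ^ (-q)`, where `c₂ = 12 K ^ 3`. As `T ≥ N`, the triangular weighting has
effective sample size at least `N / 2` and leaves at least an eighth of the radius after the drift
(`triangularWeights_bounds`); for large `K` and `c₁` this covers the mean deviation and the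
fluctuation at confidence `1 - β`. In the large-drift regime the constants make the radius larger
than the diameter of `Ξ`, so that the event is empty; as `log (1/β)` is bounded away from zero only
if `β₀ < 1`, the additive constant `c₄` is needed for `β₀ = 1`.
-/

/-! ### Wasserstein distances of order one and infinity -/

section Wasserstein

variable {X : Type*} [MeasurableSpace X]

lemma IsCoupling.measure_univ {μ ν : Measure X} {γ : Measure (X × X)} (h : IsCoupling μ ν γ) :
    γ Set.univ = μ Set.univ := by
  rw [← h.1, Measure.map_apply measurable_fst MeasurableSet.univ, Set.preimage_univ]

lemma IsCoupling.add {μ₁ μ₂ ν₁ ν₂ : Measure X} {γ₁ γ₂ : Measure (X × X)}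
    (h₁ : IsCoupling μ₁ ν₁ γ₁) (h₂ : IsCoupling μ₂ ν₂ γ₂) :
    IsCoupling (μ₁ + μ₂) (ν₁ + ν₂) (γ₁ + γ₂) :=
  ⟨by rw [Measure.map_add _ _ measurable_fst, h₁.1, h₂.1],
    by rw [Measure.map_add _ _ measurable_snd, h₁.2, h₂.2]⟩

lemma IsCoupling.smul {μ ν : Measure X} {γ : Measure (X × X)} (c : ℝ≥0∞)
    (h : IsCoupling μ ν γ) : IsCoupling (c • μ) (c • ν) (c • γ) :=
  ⟨by rw [Measure.map_smul, h.1], by rw [Measure.map_smul, h.2]⟩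

lemma isCoupling_prod (μ ν : Measure X) [IsProbabilityMeasure μ] [IsProbabilityMeasure ν] :
    IsCoupling μ ν (μ.prod ν) :=
  ⟨by rw [Measure.map_fst_prod]; simp, by rw [Measure.map_snd_prod]; simp⟩

/-- Two couplings with a common middle marginal are the two-dimensional marginals of a measure on
the triple product: disintegrate the second one over its first coordinate. -/
lemma exists_glued_measure [StandardBorelSpace X] [Nonempty X] {μ ν τ : Measure X}
    [IsFiniteMeasure μ] [IsFiniteMeasure ν] {γ₁ γ₂ : Measure (X × X)}
    (h₁ : IsCoupling μ ν γ₁) (h₂ : IsCoupling ν τ γ₂) :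
    ∃ G : Measure ((X × X) × X), G.map Prod.fst = γ₁ ∧ G.map (fun z => (z.1.2, z.2)) = γ₂ := by
  have : IsFiniteMeasure γ₁ := ⟨by rw [h₁.measure_univ]; exact measure_lt_top _ _⟩
  have : IsFiniteMeasure γ₂ := ⟨by rw [h₂.measure_univ]; exact measure_lt_top _ _⟩
  refine ⟨γ₁ ⊗ₘ (γ₂.condKernel.comap Prod.snd measurable_snd), Measure.fst_compProd _ _, ?_⟩
  refine Measure.ext_of_lintegral _ fun f hf => ?_
  rw [lintegral_map hf (by fun_prop), Measure.lintegral_compProd (by fun_prop)]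
  conv_rhs => rw [← γ₂.disintegrate γ₂.condKernel, Measure.lintegral_compProd hf, Measure.fst, h₂.1,
    ← h₁.2, lintegral_map (by fun_prop) measurable_snd]
  rfl

variable [PseudoEMetricSpace X]

lemma wassersteinDist_one (μ ν : Measure X) : wassersteinDist 1 μ ν =
    ⨅ γ : {γ : Measure (X × X) // IsCoupling μ ν γ}, ∫⁻ z, edist z.1 z.2 ∂γ.1 := by
  simp [wassersteinDist]

lemma wassersteinDist_one_le {μ ν : Measure X} {γ : Measure (X × X)} (h : IsCoupling μ ν γ) :
    wassersteinDist 1 μ ν ≤ ∫⁻ z, edist z.1 z.2 ∂γ := by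
  rw [wassersteinDist_one]
  exact iInf_le (fun γ : {γ : Measure (X × X) // IsCoupling μ ν γ} =>
    ∫⁻ z, edist z.1 z.2 ∂γ.1) ⟨γ, h⟩

lemma wassersteinDist_one_add_le (μ₁ μ₂ ν₁ ν₂ : Measure X) :
    wassersteinDist 1 (μ₁ + μ₂) (ν₁ + ν₂) ≤ wassersteinDist 1 μ₁ ν₁ + wassersteinDist 1 μ₂ ν₂ := by
  rw [wassersteinDist_one μ₁, wassersteinDist_one μ₂, ENNReal.iInf_add]
  refine le_iInf fun γ₁ => ?_
  rw [ENNReal.add_iInf]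
  refine le_iInf fun γ₂ => (wassersteinDist_one_le (γ₁.2.add γ₂.2)).trans ?_
  rw [lintegral_add_measure]

lemma wassersteinDist_one_zero : wassersteinDist 1 (0 : Measure X) 0 = 0 :=
  le_antisymm ((wassersteinDist_one_le (γ := 0) ⟨by simp, by simp⟩).trans (by simp)) bot_le

lemma wassersteinDist_one_smul_le {c : ℝ≥0∞} (hc : c ≠ ∞) (μ ν : Measure X) :
    wassersteinDist 1 (c • μ) (c • ν) ≤ c * wassersteinDist 1 μ ν := by
  rcases eq_or_ne c 0 with rfl | h0
  · simp [wassersteinDist_one_zero]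
  rw [wassersteinDist_one μ, ENNReal.mul_iInf_of_ne h0 hc]
  refine le_iInf fun γ => (wassersteinDist_one_le (γ.2.smul c)).trans ?_
  rw [lintegral_smul_measure, smul_eq_mul]

/-- Joint convexity of the Wasserstein distance of order one. -/
lemma wassersteinDist_one_sum_le {ι : Type*} (s : Finset ι) {c : ι → ℝ≥0∞} (hc : ∀ i, c i ≠ ∞)
    (μ ν : ι → Measure X) :
    wassersteinDist 1 (∑ i ∈ s, c i • μ i) (∑ i ∈ s, c i • ν i) ≤
      ∑ i ∈ s, c i * wassersteinDist 1 (μ i) (ν i) := by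
  classical
  induction s using Finset.induction_on with
  | empty => simp [wassersteinDist_one_zero]
  | insert i s hi ih =>
    rw [Finset.sum_insert hi, Finset.sum_insert hi, Finset.sum_insert hi]
    exact (wassersteinDist_one_add_le _ _ _ _).trans
      (add_le_add (wassersteinDist_one_smul_le (hc i) _ _) ih)

lemma wassersteinDist_one_le_wassersteinInfDist (μ ν : Measure X) [IsProbabilityMeasure μ] :
    wassersteinDist 1 μ ν ≤ wassersteinInfDist μ ν := by
  refine le_iInf fun γ => (wassersteinDist_one_le γ.2).trans ?_
  calc ∫⁻ z, edist z.1 z.2 ∂γ.1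
      ≤ ∫⁻ _, essSup (fun z : X × X => edist z.1 z.2) γ.1 ∂γ.1 :=
        lintegral_mono_ae (ENNReal.ae_le_essSup _)
    _ = essSup (fun z : X × X => edist z.1 z.2) γ.1 := by
        rw [lintegral_const, γ.2.measure_univ, IsProbabilityMeasure.measure_univ, mul_one]

lemma wassersteinDist_one_le_of_edist_le {d : ℝ≥0∞} (hd : ∀ x y : X, edist x y ≤ d)
    (μ ν : Measure X) [IsProbabilityMeasure μ] [IsProbabilityMeasure ν] :
    wassersteinDist 1 μ ν ≤ d := by
  refine (wassersteinDist_one_le (isCoupling_prod μ ν)).trans ?_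
  calc ∫⁻ z, edist z.1 z.2 ∂μ.prod ν ≤ ∫⁻ _, d ∂μ.prod ν := lintegral_mono fun z => hd _ _
    _ = d := by simp

variable [OpensMeasurableSpace X] [SecondCountableTopology X] [StandardBorelSpace X] [Nonempty X]

lemma wassersteinDist_one_triangle (μ ν τ : Measure X) [IsFiniteMeasure μ] [IsFiniteMeasure ν] :
    wassersteinDist 1 μ τ ≤ wassersteinDist 1 μ ν + wassersteinDist 1 ν τ := by
  rw [wassersteinDist_one μ ν, wassersteinDist_one ν τ, ENNReal.iInf_add]
  refine le_iInf fun γ₁ => ?_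
  rw [ENNReal.add_iInf]
  refine le_iInf fun γ₂ => ?_
  obtain ⟨G, hG₁, hG₂⟩ := exists_glued_measure γ₁.2 γ₂.2
  have hm : Measurable fun z : (X × X) × X => (z.1.1, z.2) := by fun_prop
  have hm' : Measurable fun z : (X × X) × X => (z.1.2, z.2) := by fun_prop
  have hγ : IsCoupling μ τ (G.map fun z => (z.1.1, z.2)) := by
    constructor
    · rw [Measure.map_map measurable_fst hm, ← γ₁.2.1, ← hG₁,
        Measure.map_map measurable_fst measurable_fst]
      rfl
    · rw [Measure.map_map measurable_snd hm, ← γ₂.2.2, ← hG₂, Measure.map_map measurable_snd hm']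
      rfl
  have hd : Measurable fun z : X × X => edist z.1 z.2 := measurable_fst.edist measurable_snd
  calc wassersteinDist 1 μ τ ≤ ∫⁻ z, edist z.1 z.2 ∂(G.map fun z => (z.1.1, z.2)) :=
        wassersteinDist_one_le hγ
    _ = ∫⁻ z, edist z.1.1 z.2 ∂G := lintegral_map hd hm
    _ ≤ ∫⁻ z, (edist z.1.1 z.1.2 + edist z.1.2 z.2) ∂G :=
        lintegral_mono fun z => edist_triangle _ _ _
    _ = ∫⁻ z, edist z.1.1 z.1.2 ∂G + ∫⁻ z, edist z.1.2 z.2 ∂G :=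
        lintegral_add_left (hd.comp measurable_fst) _
    _ = ∫⁻ z, edist z.1 z.2 ∂γ₁.1 + ∫⁻ z, edist z.1 z.2 ∂γ₂.1 := by
        rw [← hG₁, ← hG₂, lintegral_map hd measurable_fst, lintegral_map hd hm']

/-- A drift of at most `r` per step accumulates at most linearly in the look-back index. -/
lemma wassersteinDist_one_last_le {T : ℕ} {P : Fin (T + 1) → Measure X}
    (hP : ∀ t, IsProbabilityMeasure (P t)) {r : ℝ≥0∞}
    (h : ∀ t : Fin T, wassersteinInfDist (P t.castSucc) (P t.succ) ≤ r) (t : Fin (T + 1)) :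
    wassersteinDist 1 (P t) (P (Fin.last T)) ≤ ((T - t : ℕ) : ℝ≥0∞) * r := by
  induction t using Fin.reverseInduction with
  | last =>
    have hc : IsCoupling (P (Fin.last T)) (P (Fin.last T))
        ((P (Fin.last T)).map fun x => (x, x)) := by
      constructor
      · rw [Measure.map_map measurable_fst (by fun_prop)]; exact Measure.map_id
      · rw [Measure.map_map measurable_snd (by fun_prop)]; exact Measure.map_id
    refine (wassersteinDist_one_le hc).trans ?_
    rw [lintegral_map (measurable_fst.edist measurable_snd) (by fun_prop)]
    simp
  | cast j ih =>
    have e : T - (j : ℕ) = (T - (j + 1)) + 1 := by omega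
    calc wassersteinDist 1 (P j.castSucc) (P (Fin.last T))
        ≤ wassersteinDist 1 (P j.castSucc) (P j.succ) +
            wassersteinDist 1 (P j.succ) (P (Fin.last T)) := wassersteinDist_one_triangle _ _ _
      _ ≤ r + ((T - (j.succ : ℕ) : ℕ) : ℝ≥0∞) * r :=
          add_le_add ((wassersteinDist_one_le_wassersteinInfDist _ _).trans (h j)) ih
      _ = ((T - (j.castSucc : ℕ) : ℕ) : ℝ≥0∞) * r := by
          simp only [Fin.val_succ, Fin.val_castSucc, e]
          push_cast
          ring

end Wasserstein

/-! ### Multi-scale couplings -/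

section Multiscale

variable {X : Type*} [MeasurableSpace X]

lemma exists_isCoupling_of_measure_univ_eq (μ ν : Measure X) [IsFiniteMeasure μ]
    [IsFiniteMeasure ν] (h : μ Set.univ = ν Set.univ) : ∃ γ, IsCoupling μ ν γ := by
  rcases eq_or_ne (μ Set.univ) 0 with h0 | h0
  · have h0' : ν Set.univ = 0 := h ▸ h0
    rw [Measure.measure_univ_eq_zero.1 h0, Measure.measure_univ_eq_zero.1 h0']
    exact ⟨0, by simp, by simp⟩
  have hc : (μ Set.univ)⁻¹ * μ Set.univ = 1 := ENNReal.inv_mul_cancel h0 (measure_ne_top _ _)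
  refine ⟨(μ Set.univ)⁻¹ • μ.prod ν, ?_, ?_⟩
  · rw [Measure.map_smul, Measure.map_fst_prod, smul_smul, ← h, hc, one_smul]
  · rw [Measure.map_smul, Measure.map_snd_prod, smul_smul, hc, one_smul]

lemma sum_restrict_fiber {ι : Type*} [Fintype ι] (μ : Measure X) {π : X → ι}
    (hπ : ∀ i, MeasurableSet (π ⁻¹' {i})) : ∑ i, μ.restrict (π ⁻¹' {i}) = μ := by
  rw [← Measure.sum_fintype, ← Measure.restrict_iUnion _ hπ]
  · rw [← Set.preimage_iUnion, Set.iUnion_of_singleton, Set.preimage_univ, Measure.restrict_univ]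
  · exact fun i j hij => Disjoint.preimage _ (Set.disjoint_singleton.2 hij)

lemma sum_measure_fiber {ι : Type*} [Fintype ι] (μ : Measure X) {π : X → ι}
    (hπ : ∀ i, MeasurableSet (π ⁻¹' {i})) : ∑ i, μ (π ⁻¹' {i}) = μ Set.univ := by
  conv_rhs => rw [← sum_restrict_fiber μ hπ]
  simp

/-- The part of a finite measure `μ` which can be matched, inside the cells of a finite partition,
with a measure giving mass `b i` to the `i`-th cell, and the remaining part. -/
lemma exists_matched_part {ι : Type*} [Fintype ι] (μ : Measure X) [IsFiniteMeasure μ] {π : X → ι}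
    (hπ : ∀ i, MeasurableSet (π ⁻¹' {i})) (b : ι → ℝ≥0∞) :
    ∃ (κ : ι → Measure X) (μ' : Measure X), ∑ i, κ i + μ' = μ ∧
      (∀ i, ∀ᵐ x ∂κ i, π x = i) ∧ (∀ i, κ i Set.univ = min (μ (π ⁻¹' {i})) (b i)) ∧
      ∀ i, μ' (π ⁻¹' {i}) = μ (π ⁻¹' {i}) - b i := by
  set a : ι → ℝ≥0∞ := fun i => μ (π ⁻¹' {i}) with ha
  have hα : ∀ i, min (a i) (b i) / a i ≤ 1 := fun i =>
    ENNReal.div_le_of_le_mul (by rw [one_mul]; exact min_le_left _ _)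
  have hmul : ∀ i, min (a i) (b i) / a i * a i = min (a i) (b i) := fun i => by
    rcases eq_or_ne (a i) 0 with h | h
    · simp [h]
    · exact ENNReal.div_mul_cancel h (measure_ne_top _ _)
  have hrest : ∀ i j, i ≠ j → μ.restrict (π ⁻¹' {i}) (π ⁻¹' {j}) = 0 := fun i j hij => by
    rw [Measure.restrict_apply (hπ j)]
    have : π ⁻¹' {j} ∩ π ⁻¹' {i} = ∅ := by
      ext x; simp only [Set.mem_inter_iff, Set.mem_preimage, Set.mem_singleton_iff,
        Set.mem_empty_iff_false, iff_false, not_and]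
      rintro rfl h; exact hij h.symm
    rw [this, measure_empty]
  refine ⟨fun i => (min (a i) (b i) / a i) • μ.restrict (π ⁻¹' {i}),
    ∑ i, (1 - min (a i) (b i) / a i) • μ.restrict (π ⁻¹' {i}), ?_, ?_, ?_, ?_⟩
  · rw [← Finset.sum_add_distrib]
    conv_rhs => rw [← sum_restrict_fiber μ hπ]
    exact Finset.sum_congr rfl fun i _ => by rw [← add_smul, add_tsub_cancel_of_le (hα i), one_smul]
  · exact fun i => Measure.ae_smul_measure (ae_restrict_mem (hπ i)) _
  · intro i
    simp only [Measure.smul_apply, Measure.restrict_apply_univ, smul_eq_mul]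
    exact hmul i
  · intro i
    rw [Measure.finsetSum_apply, Finset.sum_eq_single i]
    · simp only [Measure.smul_apply, Measure.restrict_apply_self, smul_eq_mul]
      change (1 - min (a i) (b i) / a i) * a i = a i - b i
      rw [ENNReal.sub_mul (fun _ _ => measure_ne_top _ _), one_mul, hmul, tsub_min]
    · intro j _ hj
      rw [Measure.smul_apply, hrest j i hj, smul_zero]
    · simp

/-- Greedy matching inside the cells of a finite partition. The unmatched parts `μ'` and `ν'` carry
on each cell the positive and the negative part of the difference of the masses. -/
lemma exists_greedy_matching {ι : Type*} [Fintype ι] (μ ν : Measure X) [IsFiniteMeasure μ]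
    [IsFiniteMeasure ν] {π : X → ι} (hπ : ∀ i, MeasurableSet (π ⁻¹' {i})) :
    ∃ (γ : Measure (X × X)) (μ' ν' : Measure X), γ.map Prod.fst + μ' = μ ∧
      γ.map Prod.snd + ν' = ν ∧ (∀ᵐ z ∂γ, π z.1 = π z.2) ∧
      ∀ i, μ' (π ⁻¹' {i}) = μ (π ⁻¹' {i}) - ν (π ⁻¹' {i}) := by
  obtain ⟨κ, μ', h₁, h₂, h₃, h₄⟩ := exists_matched_part μ hπ fun i => ν (π ⁻¹' {i})
  obtain ⟨η, ν', k₁, k₂, k₃, -⟩ := exists_matched_part ν hπ fun i => μ (π ⁻¹' {i})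
  have hfin : ∀ i, IsFiniteMeasure (κ i) := fun i =>
    ⟨by rw [h₃]; exact (min_le_left _ _).trans_lt (measure_lt_top _ _)⟩
  have kfin : ∀ i, IsFiniteMeasure (η i) := fun i =>
    ⟨by rw [k₃]; exact (min_le_left _ _).trans_lt (measure_lt_top _ _)⟩
  have hγ : ∀ i, ∃ γ, IsCoupling (κ i) (η i) γ := fun i =>
    exists_isCoupling_of_measure_univ_eq _ _ (by rw [h₃, k₃, min_comm])
  choose γ hγ using hγ
  refine ⟨∑ i, γ i, μ', ν', ?_, ?_, ?_, h₄⟩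
  · rw [← Measure.sum_fintype, Measure.map_sum measurable_fst.aemeasurable, Measure.sum_fintype]
    simp_rw [(hγ _).1]
    exact h₁
  · rw [← Measure.sum_fintype, Measure.map_sum measurable_snd.aemeasurable, Measure.sum_fintype]
    simp_rw [(hγ _).2]
    exact k₁
  · rw [← Measure.sum_fintype, Measure.ae_sum_iff]
    intro i
    have e₁ : ∀ᵐ z ∂γ i, π z.1 = i :=
      ae_of_ae_map measurable_fst.aemeasurable (by rw [(hγ i).1]; exact h₂ i)
    have e₂ : ∀ᵐ z ∂γ i, π z.2 = i :=
      ae_of_ae_map measurable_snd.aemeasurable (by rw [(hγ i).2]; exact k₂ i)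
    filter_upwards [e₁, e₂] with z hz₁ hz₂
    rw [hz₁, hz₂]

variable [PseudoEMetricSpace X]

/-- Multi-scale coupling bound for a refining sequence of finite partitions whose cells at level
`k` have diameter at most `δ k`. As much mass as possible is matched inside the finest cells, what
is left over inside the cells of the next coarser level, and so on. The mass which is left over
after level `j + 1` is the sum of the positive parts of the differences of the masses of its cells,
because matching inside finer cells does not change these differences. -/
theorem exists_multiscale_coupling {ι : ℕ → Type*} [∀ k, Fintype (ι k)] (π : ∀ k, X → ι k)
    (hπ : ∀ k i, MeasurableSet (π k ⁻¹' {i}))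
    (hnest : ∀ k x y, π (k + 1) x = π (k + 1) y → π k x = π k y)
    (hzero : ∀ x y, π 0 x = π 0 y)
    {δ : ℕ → ℝ≥0∞} (hδ : ∀ k x y, π k x = π k y → edist x y ≤ δ k) (k : ℕ)
    (μ ν : Measure X) [IsFiniteMeasure μ] [IsFiniteMeasure ν] (h : μ Set.univ = ν Set.univ) :
    ∃ γ, IsCoupling μ ν γ ∧ ∫⁻ z, edist z.1 z.2 ∂γ ≤ δ k * μ Set.univ +
      ∑ j ∈ Finset.range k, δ j *
        ∑ i, (μ (π (j + 1) ⁻¹' {i}) - ν (π (j + 1) ⁻¹' {i})) := by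
  induction k generalizing μ ν with
  | zero =>
    obtain ⟨γ, hγ⟩ := exists_isCoupling_of_measure_univ_eq μ ν h
    refine ⟨γ, hγ, ?_⟩
    calc ∫⁻ z, edist z.1 z.2 ∂γ ≤ ∫⁻ _, δ 0 ∂γ := lintegral_mono fun z => hδ 0 _ _ (hzero _ _)
      _ = δ 0 * μ Set.univ := by rw [lintegral_const, hγ.measure_univ]
      _ ≤ _ := le_self_add
  | succ k ih =>
    obtain ⟨γ, μ', ν', h₁, h₂, h₃, h₄⟩ := exists_greedy_matching μ ν (hπ (k + 1))
    have hγ : γ Set.univ ≤ μ Set.univ := by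
      rw [← h₁, Measure.add_apply, Measure.map_apply measurable_fst MeasurableSet.univ]
      exact le_self_add
    have : IsFiniteMeasure γ := ⟨hγ.trans_lt (measure_lt_top _ _)⟩
    have hμ' : IsFiniteMeasure μ' :=
      isFiniteMeasure_of_le μ (by rw [← h₁]; exact Measure.le_add_left le_rfl)
    have hν' : IsFiniteMeasure ν' :=
      isFiniteMeasure_of_le ν (by rw [← h₂]; exact Measure.le_add_left le_rfl)
    have hmass : μ' Set.univ = ν' Set.univ := by
      rw [← h₁, ← h₂, Measure.add_apply, Measure.add_apply,
        Measure.map_apply measurable_fst MeasurableSet.univ,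
        Measure.map_apply measurable_snd MeasurableSet.univ] at h
      exact (ENNReal.add_right_inj (measure_ne_top γ _)).1 h
    obtain ⟨γ', hγ', hcost⟩ := ih μ' ν' hmass
    have hchain : ∀ j, j ≤ k + 1 → ∀ᵐ z ∂γ, π j z.1 = π j z.2 := fun j hj => by
      induction hj using Nat.decreasingInduction with
      | self => exact h₃
      | of_succ j _ ih => exact ih.mono fun z hz => hnest j _ _ hz
    have hdiff : ∀ j, j ≤ k + 1 → ∀ i, μ' (π j ⁻¹' {i}) - ν' (π j ⁻¹' {i}) ≤
        μ (π j ⁻¹' {i}) - ν (π j ⁻¹' {i}) := fun j hj i => by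
      have e : γ (Prod.fst ⁻¹' (π j ⁻¹' {i})) = γ (Prod.snd ⁻¹' (π j ⁻¹' {i})) := by
        refine measure_congr ?_
        filter_upwards [hchain j hj] with z hz
        exact propext (by
          change π j z.1 = i ↔ π j z.2 = i
          rw [hz])
      rw [← h₁, ← h₂, Measure.add_apply, Measure.add_apply, Measure.map_apply measurable_fst (hπ j i),
        Measure.map_apply measurable_snd (hπ j i), e,
        ENNReal.add_sub_add_eq_sub_left (measure_ne_top _ _)]
    refine ⟨γ + γ', ⟨?_, ?_⟩, ?_⟩
    · rw [Measure.map_add _ _ measurable_fst, hγ'.1, h₁]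
    · rw [Measure.map_add _ _ measurable_snd, hγ'.2, h₂]
    rw [lintegral_add_measure, Finset.sum_range_succ]
    have c₁ : ∫⁻ z, edist z.1 z.2 ∂γ ≤ δ (k + 1) * μ Set.univ :=
      calc ∫⁻ z, edist z.1 z.2 ∂γ ≤ ∫⁻ _, δ (k + 1) ∂γ :=
            lintegral_mono_ae (h₃.mono fun z hz => hδ _ _ _ hz)
        _ ≤ δ (k + 1) * μ Set.univ := by rw [lintegral_const]; gcongr
    have c₂ : μ' Set.univ = ∑ i, (μ (π (k + 1) ⁻¹' {i}) - ν (π (k + 1) ⁻¹' {i})) := by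
      rw [← sum_measure_fiber μ' (hπ (k + 1))]
      exact Finset.sum_congr rfl fun i _ => h₄ i
    rw [c₂] at hcost
    refine add_le_add c₁ (hcost.trans ?_)
    rw [add_comm]
    refine add_le_add_left (Finset.sum_le_sum fun j hj => ?_) _
    gcongr δ j * ?_
    exact Finset.sum_le_sum fun i _ =>
      hdiff (j + 1) (by have := Finset.mem_range.1 hj; omega) i

end Multiscale

/-! ### The bounded differences inequality -/

section BoundedDifferences

open scoped NNReal

variable {X : Type*} [MeasurableSpace X]

/-- Hoeffding's lemma, for a function which oscillates by at most `c`. -/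
lemma integral_exp_sub_integral_le (P : Measure X) [IsProbabilityMeasure P] {f : X → ℝ}
    (hf : Measurable f) {c : ℝ} (hc : 0 ≤ c) (h : ∀ x y, |f x - f y| ≤ c) (s : ℝ) :
    ∫ x, Real.exp (s * (f x - ∫ y, f y ∂P)) ∂P ≤ Real.exp (c ^ 2 * s ^ 2 / 2) := by
  obtain ⟨x₀⟩ : Nonempty X := nonempty_of_isProbabilityMeasure P
  have hI : ∀ᵐ x ∂P, f x ∈ Set.Icc (f x₀ - c) (f x₀ + c) := Filter.Eventually.of_forall fun x => by
    have := abs_le.1 (h x x₀)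
    constructor <;> linarith
  have := (hasSubgaussianMGF_of_mem_Icc hf.aemeasurable hI).mgf_le s
  refine this.trans_eq ?_
  have e : ((‖f x₀ + c - (f x₀ - c)‖₊ / 2) ^ 2 : ℝ≥0) = (c ^ 2 : ℝ) := by
    have : f x₀ + c - (f x₀ - c) = 2 * c := by ring
    rw [this]
    push_cast
    rw [Real.norm_of_nonneg (by positivity)]
    ring
  rw [e]

/-- The moment generating function bound behind the bounded differences inequality. It follows by
induction on the number of coordinates, with Hoeffding's lemma applied to the first coordinate. -/
lemma integral_exp_le_of_bounded_differences {n : ℕ} (P : Fin n → Measure X)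
    [∀ t, IsProbabilityMeasure (P t)] {F : (Fin n → X) → ℝ} (hF : Measurable F) {B : ℝ}
    (hB : ∀ x, |F x| ≤ B) {c : Fin n → ℝ} (hc : ∀ t, 0 ≤ c t)
    (hd : ∀ t x y, |F (Function.update x t y) - F x| ≤ c t) (s : ℝ) :
    ∫ x, Real.exp (s * (F x - ∫ y, F y ∂Measure.pi P)) ∂Measure.pi P ≤
      Real.exp ((∑ t, c t ^ 2) * s ^ 2 / 2) := by
  induction n generalizing B with
  | zero =>
    have : ∀ x, F x = F default := fun x => congrArg F (Subsingleton.elim _ _)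
    simp [this]
  | succ n ih =>
    set Q : Fin n → Measure X := fun t => P t.succ with hQ
    have hcons : Measurable fun z : X × (Fin n → X) => (Fin.cons z.1 z.2 : Fin (n + 1) → X) := by
      refine measurable_pi_lambda _ fun t => ?_
      refine Fin.cases ?_ (fun t => ?_) t
      · simpa using measurable_fst
      · simpa [Function.comp_def] using (measurable_pi_apply t).comp (measurable_snd (α := X))
    have hmp : MeasurePreserving (fun z : X × (Fin n → X) => (Fin.cons z.1 z.2 : Fin (n + 1) → X))
        ((P 0).prod (Measure.pi Q)) (Measure.pi P) := by
      have := (measurePreserving_piFinSuccAbove P 0).symm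
      simpa [MeasurableEquiv.piFinSuccAbove_symm_apply, Fin.insertNthEquiv] using this
    have hint : ∀ f : (Fin (n + 1) → X) → ℝ, Measurable f → (∃ C, ∀ x, |f x| ≤ C) →
        ∫ x, f x ∂Measure.pi P = ∫ y, ∫ x, f (Fin.cons x y) ∂P 0 ∂Measure.pi Q := by
      rintro f hf ⟨C, hC⟩
      rw [← hmp.map_eq, integral_map hcons.aemeasurable hf.aestronglyMeasurable]
      exact integral_prod_symm _ (Integrable.of_bound (hf.comp hcons).aestronglyMeasurable C
        (Filter.Eventually.of_forall fun z => hC _))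
    set G : (Fin n → X) → ℝ := fun y => ∫ x, F (Fin.cons x y) ∂P 0 with hG
    have hFy : ∀ y : Fin n → X, Measurable fun x => F (Fin.cons x y) := fun y =>
      hF.comp (hcons.comp (measurable_id.prodMk measurable_const))
    have hFi : ∀ y : Fin n → X, Integrable (fun x => F (Fin.cons x y)) (P 0) := fun y =>
      Integrable.of_bound (hFy y).aestronglyMeasurable B (Filter.Eventually.of_forall fun z => hB _)
    have hGm : Measurable G := by
      have : StronglyMeasurable fun z : (Fin n → X) × X => F (Fin.cons z.2 z.1) :=
        (hF.comp (hcons.comp measurable_swap)).stronglyMeasurable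
      exact this.integral_prod_right.measurable
    have hGB : ∀ y, |G y| ≤ B := fun y => by
      have := norm_integral_le_of_norm_le_const (μ := P 0) (f := fun x => F (Fin.cons x y)) (C := B)
        (Filter.Eventually.of_forall fun x => hB _)
      simpa using this
    have hGd : ∀ t y z, |G (Function.update y t z) - G y| ≤ c t.succ := fun t y z => by
      rw [hG, ← integral_sub (hFi _) (hFi _)]
      have := norm_integral_le_of_norm_le_const (μ := P 0)
        (f := fun x => F (Fin.cons x (Function.update y t z)) - F (Fin.cons x y)) (C := c t.succ)
        (Filter.Eventually.of_forall fun x => by rw [Fin.cons_update]; exact hd _ _ _)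
      simpa using this
    have hmean : ∫ x, F x ∂Measure.pi P = ∫ y, G y ∂Measure.pi Q := hint F hF ⟨B, hB⟩
    set E := ∫ y, G y ∂Measure.pi Q
    have hexp : ∀ (Y : Type _) (f : Y → ℝ), (∀ x, |f x| ≤ B) → ∀ e x,
        Real.exp (s * (f x - e)) ≤ Real.exp (|s| * (B + |e|)) := fun Y f hf e x => by
      refine Real.exp_le_exp.2 ((le_abs_self _).trans ?_)
      rw [abs_mul]
      gcongr
      exact (abs_sub _ _).trans (by gcongr; exact hf x)
    rw [hmean, hint _ (by fun_prop) ⟨Real.exp (|s| * (B + |E|)), fun x => by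
      rw [abs_of_pos (Real.exp_pos _)]; exact hexp _ F hB E x⟩]
    have hsplit : ∀ y, ∫ x, Real.exp (s * (F (Fin.cons x y) - E)) ∂P 0 ≤
        Real.exp (c 0 ^ 2 * s ^ 2 / 2) * Real.exp (s * (G y - E)) := fun y => by
      have : ∀ x, Real.exp (s * (F (Fin.cons x y) - E)) =
          Real.exp (s * (F (Fin.cons x y) - G y)) * Real.exp (s * (G y - E)) := fun x => by
        rw [← Real.exp_add]; ring_nf
      simp_rw [this, integral_mul_const]
      gcongr
      refine integral_exp_sub_integral_le (P 0) (hFy y) (hc 0) (fun x x' => ?_) s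
      have := hd 0 (Fin.cons x' y) x
      rwa [Fin.update_cons_zero] at this
    have hGi : Integrable (fun y => Real.exp (s * (G y - E))) (Measure.pi Q) :=
      Integrable.of_bound (by fun_prop) (Real.exp (|s| * (B + |E|)))
        (Filter.Eventually.of_forall fun y => by
          rw [Real.norm_of_nonneg (Real.exp_pos _).le]; exact hexp _ G hGB E y)
    calc ∫ y, ∫ x, Real.exp (s * (F (Fin.cons x y) - E)) ∂P 0 ∂Measure.pi Q
        ≤ ∫ y, Real.exp (c 0 ^ 2 * s ^ 2 / 2) * Real.exp (s * (G y - E)) ∂Measure.pi Q :=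
          integral_mono_of_nonneg
            (Filter.Eventually.of_forall fun y => integral_nonneg fun x => (Real.exp_pos _).le)
            (hGi.const_mul _) (Filter.Eventually.of_forall hsplit)
      _ = Real.exp (c 0 ^ 2 * s ^ 2 / 2) * ∫ y, Real.exp (s * (G y - E)) ∂Measure.pi Q :=
          integral_const_mul _ _
      _ ≤ Real.exp (c 0 ^ 2 * s ^ 2 / 2) * Real.exp ((∑ t : Fin n, c t.succ ^ 2) * s ^ 2 / 2) := by
          gcongr
          exact ih Q hGm hGB (fun t => hc t.succ) hGd
      _ = Real.exp ((∑ t, c t ^ 2) * s ^ 2 / 2) := by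
          rw [← Real.exp_add, Fin.sum_univ_succ]; ring_nf

/-- The bounded differences inequality (McDiarmid), with a constant that is not optimized. -/
theorem measure_pi_ge_le_of_bounded_differences {n : ℕ} (P : Fin n → Measure X)
    [∀ t, IsProbabilityMeasure (P t)] {F : (Fin n → X) → ℝ} (hF : Measurable F) {B : ℝ}
    (hB : ∀ x, |F x| ≤ B) {c : Fin n → ℝ} (hc : ∀ t, 0 ≤ c t)
    (hd : ∀ t x y, |F (Function.update x t y) - F x| ≤ c t) {s : ℝ} (hs : 0 ≤ s) :
    Measure.pi P {x | (∫ y, F y ∂Measure.pi P) + s ≤ F x} ≤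
      ENNReal.ofReal (Real.exp (-s ^ 2 / (2 * ∑ t, c t ^ 2))) := by
  set E := ∫ y, F y ∂Measure.pi P
  have hv : 0 ≤ ∑ t, c t ^ 2 := Finset.sum_nonneg fun t _ => sq_nonneg _
  have hFE : ∀ x, |F x - E| ≤ B + |E| := fun x => (abs_sub _ _).trans (by gcongr; exact hB x)
  have hsub : HasSubgaussianMGF (fun x => F x - E) ⟨∑ t, c t ^ 2, hv⟩ (Measure.pi P) :=
    ⟨fun u => integrable_exp_mul_of_mem_Icc (by fun_prop)
      (Filter.Eventually.of_forall fun x => abs_le.1 (hFE x)),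
    fun u => integral_exp_le_of_bounded_differences P hF hB hc hd u⟩
  have := hsub.measure_ge_le hs
  rw [ENNReal.le_ofReal_iff_toReal_le (measure_ne_top _ _) (Real.exp_pos _).le]
  have hset : {x | E + s ≤ F x} = {x | s ≤ F x - E} := by
    ext x
    exact (le_sub_iff_add_le'.symm : E + s ≤ F x ↔ s ≤ F x - E)
  rw [hset]
  exact this

end BoundedDifferences

/-! ### Discrepancy of a weighted sample on the cells of a partition -/

section Discrepancy

lemma sum_indicator_fiber {X ι : Type*} [Fintype ι] (π : X → ι) (x : X) :
    ∑ i, (π ⁻¹' {i}).indicator (fun _ => (1 : ℝ)) x = 1 := by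
  classical
  simp [Set.indicator_apply]

lemma indicator_one_nonneg {X : Type*} (C : Set X) (x : X) : 0 ≤ C.indicator (fun _ => (1 : ℝ)) x :=
  Set.indicator_nonneg (fun _ _ => zero_le_one) x

variable {X : Type*} [MeasurableSpace X] {n : ℕ}

/-- The difference of the masses which the weighted empirical distribution of the sample `x` and
the mixture `∑ₜ wₜ Pₜ` give to the set `C`. -/
noncomputable def cellDeviation (w : Fin n → ℝ) (P : Fin n → Measure X) (C : Set X) (x : Fin n → X) : ℝ :=
  ∑ t, w t * (C.indicator (fun _ => (1 : ℝ)) (x t) - (P t).real C)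

/-- The total absolute deviation over the cells of the finite partition given by the fibres of
`π`. -/
noncomputable def partitionDiscrepancy {ι : Type*} [Fintype ι] (w : Fin n → ℝ) (P : Fin n → Measure X)
    (π : X → ι) (x : Fin n → X) : ℝ :=
  ∑ i, |cellDeviation w P (π ⁻¹' {i}) x|

lemma measurable_cellDeviation (w : Fin n → ℝ) (P : Fin n → Measure X) {C : Set X}
    (hC : MeasurableSet C) : Measurable (cellDeviation w P C) := by
  refine Finset.measurable_sum _ fun t _ => Measurable.const_mul (Measurable.sub_const ?_ _) _
  exact (measurable_const.indicator hC).comp (measurable_pi_apply t)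

lemma measurable_partitionDiscrepancy {ι : Type*} [Fintype ι] (w : Fin n → ℝ)
    (P : Fin n → Measure X) {π : X → ι} (hπ : ∀ i, MeasurableSet (π ⁻¹' {i})) :
    Measurable (partitionDiscrepancy w P π) :=
  Finset.measurable_sum _ fun i _ => (measurable_cellDeviation w P (hπ i)).abs

lemma sum_measureReal_fiber {ι : Type*} [Fintype ι] (P : Measure X) [IsProbabilityMeasure P]
    {π : X → ι} (hπ : ∀ i, MeasurableSet (π ⁻¹' {i})) : ∑ i, P.real (π ⁻¹' {i}) = 1 := by
  rw [← measureReal_biUnion_finset (fun i _ j _ hij =>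
      Disjoint.preimage _ (Set.disjoint_singleton.2 hij)) fun i _ => hπ i]
  have : (⋃ i ∈ Finset.univ, π ⁻¹' {i}) = Set.univ := by ext x; simp
  rw [this, probReal_univ]

lemma partitionDiscrepancy_nonneg {ι : Type*} [Fintype ι] (w : Fin n → ℝ) (P : Fin n → Measure X)
    (π : X → ι) (x : Fin n → X) : 0 ≤ partitionDiscrepancy w P π x :=
  Finset.sum_nonneg fun _ _ => abs_nonneg _

lemma partitionDiscrepancy_le_two {ι : Type*} [Fintype ι] {w : Fin n → ℝ}
    (hw : w ∈ stdSimplex ℝ (Fin n)) (P : Fin n → Measure X) [∀ t, IsProbabilityMeasure (P t)]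
    {π : X → ι} (hπ : ∀ i, MeasurableSet (π ⁻¹' {i})) (x : Fin n → X) :
    partitionDiscrepancy w P π x ≤ 2 := by
  calc partitionDiscrepancy w P π x
      ≤ ∑ i, ∑ t, w t * ((π ⁻¹' {i}).indicator (fun _ => (1 : ℝ)) (x t) +
          (P t).real (π ⁻¹' {i})) := by
        refine Finset.sum_le_sum fun i _ => (Finset.abs_sum_le_sum_abs _ _).trans ?_
        refine Finset.sum_le_sum fun t _ => ?_
        rw [abs_mul, abs_of_nonneg (hw.1 t)]
        refine mul_le_mul_of_nonneg_left ((abs_sub _ _).trans_eq ?_) (hw.1 t)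
        rw [abs_of_nonneg (indicator_one_nonneg _ _), abs_of_nonneg measureReal_nonneg]
    _ = ∑ t, w t * 2 := by
        rw [Finset.sum_comm]
        refine Finset.sum_congr rfl fun t _ => ?_
        rw [← Finset.mul_sum, Finset.sum_add_distrib, sum_indicator_fiber,
          sum_measureReal_fiber _ hπ]
        norm_num
    _ = 2 := by rw [← Finset.sum_mul, hw.2, one_mul]

lemma abs_partitionDiscrepancy_update_sub_le {ι : Type*} [Fintype ι] {w : Fin n → ℝ}
    (hw : ∀ t, 0 ≤ w t) (P : Fin n → Measure X) (π : X → ι) (t : Fin n) (x : Fin n → X) (y : X) :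
    |partitionDiscrepancy w P π (Function.update x t y) - partitionDiscrepancy w P π x| ≤
      2 * w t := by
  have hdiff : ∀ C : Set X, cellDeviation w P C (Function.update x t y) - cellDeviation w P C x =
      w t * (C.indicator (fun _ => (1 : ℝ)) y - C.indicator (fun _ => (1 : ℝ)) (x t)) := by
    intro C
    rw [cellDeviation, cellDeviation, ← Finset.sum_sub_distrib, Finset.sum_eq_single t]
    · rw [Function.update_self]; ring
    · intro s _ hs
      rw [Function.update_of_ne hs, sub_self]
    · simp
  rw [partitionDiscrepancy, partitionDiscrepancy, ← Finset.sum_sub_distrib]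
  calc |∑ i, (|cellDeviation w P (π ⁻¹' {i}) (Function.update x t y)| -
          |cellDeviation w P (π ⁻¹' {i}) x|)|
      ≤ ∑ i, w t * ((π ⁻¹' {i}).indicator (fun _ => (1 : ℝ)) y +
          (π ⁻¹' {i}).indicator (fun _ => (1 : ℝ)) (x t)) := by
        refine (Finset.abs_sum_le_sum_abs _ _).trans (Finset.sum_le_sum fun i _ => ?_)
        refine (abs_abs_sub_abs_le _ _).trans ?_
        rw [hdiff, abs_mul, abs_of_nonneg (hw t)]
        refine mul_le_mul_of_nonneg_left ((abs_sub _ _).trans_eq ?_) (hw t)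
        rw [abs_of_nonneg (indicator_one_nonneg _ _), abs_of_nonneg (indicator_one_nonneg _ _)]
    _ = 2 * w t := by
        rw [← Finset.mul_sum, Finset.sum_add_distrib, sum_indicator_fiber, sum_indicator_fiber]
        ring

lemma integrable_pi_of_abs_le (P : Fin n → Measure X) [∀ t, IsProbabilityMeasure (P t)]
    {f : (Fin n → X) → ℝ} (hf : Measurable f) {B : ℝ} (h : ∀ x, |f x| ≤ B) :
    Integrable f (Measure.pi P) :=
  Integrable.of_bound hf.aestronglyMeasurable B (Filter.Eventually.of_forall h)

lemma abs_cellDeviation_le {w : Fin n → ℝ} (hw : ∀ t, 0 ≤ w t) (P : Fin n → Measure X)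
    [∀ t, IsProbabilityMeasure (P t)] (C : Set X) (x : Fin n → X) :
    |cellDeviation w P C x| ≤ ∑ t, w t := by
  refine (Finset.abs_sum_le_sum_abs _ _).trans (Finset.sum_le_sum fun t _ => ?_)
  rw [abs_mul, abs_of_nonneg (hw t)]
  refine mul_le_of_le_one_right (hw t) (abs_sub_le_iff.2 ⟨?_, ?_⟩)
  · have : C.indicator (fun _ => (1 : ℝ)) (x t) ≤ 1 :=
      Set.indicator_apply_le' (fun _ => le_rfl) fun _ => zero_le_one
    linarith [measureReal_nonneg (μ := P t) (s := C)]
  · linarith [indicator_one_nonneg C (x t), measureReal_le_one (μ := P t) (s := C)]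

/-- The second moment of the deviation on one cell is a variance of a sum of independent terms. -/
lemma integral_cellDeviation_sq_le {w : Fin n → ℝ} (P : Fin n → Measure X)
    [∀ t, IsProbabilityMeasure (P t)] {C : Set X} (hC : MeasurableSet C) :
    ∫ x, cellDeviation w P C x ^ 2 ∂Measure.pi P ≤ ∑ t, w t ^ 2 * (P t).real C := by
  set Y : Fin n → X → ℝ := fun t y => w t * (C.indicator (fun _ => (1 : ℝ)) y - (P t).real C)
  have hind : Measurable (C.indicator fun _ => (1 : ℝ)) := measurable_const.indicator hC
  have hL : ∀ t, MemLp (C.indicator fun _ => (1 : ℝ)) 2 (P t) := fun t =>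
    memLp_indicator_const 2 hC 1 (Or.inr (measure_ne_top _ _))
  have hY : ∀ t, MemLp (Y t) 2 (P t) := fun t => ((hL t).sub (memLp_const _)).const_mul _
  have hY0 : ∀ t, ∫ y, Y t y ∂P t = 0 := fun t => by
    rw [integral_const_mul, integral_sub ((hL t).integrable one_le_two) (integrable_const _),
      integral_indicator_const _ hC]
    simp
  have hsum : (∑ t, fun x : Fin n → X => Y t (x t)) = cellDeviation w P C := by
    ext x; simp [cellDeviation, Y]
  have hmean : ∫ x, cellDeviation w P C x ∂Measure.pi P = 0 := by
    rw [← hsum]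
    simp only [Finset.sum_apply]
    rw [integral_finsetSum]
    · refine Finset.sum_eq_zero fun t _ => ?_
      have hm := measurePreserving_eval P t
      have : ∫ x, Y t (x t) ∂Measure.pi P = ∫ y, Y t y ∂P t := by
        conv_rhs => rw [← hm.map_eq]
        exact (integral_map hm.measurable.aemeasurable
          (by rw [hm.map_eq]; exact (hY t).aestronglyMeasurable)).symm
      rw [this, hY0]
    · exact fun t _ => ((hY t).comp_measurePreserving
        (measurePreserving_eval P t)).integrable one_le_two
  rw [← variance_of_integral_eq_zero (measurable_cellDeviation w P hC).aemeasurable hmean, ← hsum,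
    variance_sum_pi hY]
  refine Finset.sum_le_sum fun t _ => ?_
  rw [variance_const_mul, variance_sub_const hind.aestronglyMeasurable]
  refine mul_le_mul_of_nonneg_left ?_ (sq_nonneg _)
  refine (variance_le_expectation_sq hind.aestronglyMeasurable).trans_eq ?_
  have : (C.indicator (fun _ => (1 : ℝ))) ^ 2 = C.indicator fun _ => (1 : ℝ) := by
    ext y; by_cases hy : y ∈ C <;> simp [hy]
  rw [this, integral_indicator_const _ hC]
  simp

lemma sq_integral_le_integral_sq {Ω : Type*} [MeasurableSpace Ω] {P : Measure Ω}
    [IsProbabilityMeasure P] {f : Ω → ℝ} (hf : MemLp f 2 P) :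
    (∫ x, f x ∂P) ^ 2 ≤ ∫ x, f x ^ 2 ∂P := by
  have h := variance_nonneg f P
  rw [variance_eq_sub hf] at h
  simpa using h

/-- By the Cauchy–Schwarz inequality, the expected discrepancy over a partition is at most the
square root of the number of cells divided by the effective sample size. -/
lemma integral_partitionDiscrepancy_le {ι : Type*} [Fintype ι] {w : Fin n → ℝ}
    (hw : w ∈ stdSimplex ℝ (Fin n)) (P : Fin n → Measure X) [∀ t, IsProbabilityMeasure (P t)]
    {π : X → ι} (hπ : ∀ i, MeasurableSet (π ⁻¹' {i})) :
    ∫ x, partitionDiscrepancy w P π x ∂Measure.pi P ≤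
      √(Fintype.card ι * ∑ t, w t ^ 2) := by
  refine Real.le_sqrt_of_sq_le ?_
  have hm := measurable_partitionDiscrepancy w P hπ
  have hb : ∀ x, |partitionDiscrepancy w P π x| ≤ 2 := fun x => by
    rw [abs_of_nonneg (partitionDiscrepancy_nonneg _ _ _ _)]
    exact partitionDiscrepancy_le_two hw P hπ x
  have hcb : ∀ i x, |cellDeviation w P (π ⁻¹' {i}) x ^ 2| ≤ 1 := fun i x => by
    have := abs_cellDeviation_le hw.1 P (π ⁻¹' {i}) x
    rw [hw.2] at this
    rw [abs_pow]
    exact pow_le_one₀ (abs_nonneg _) this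
  have hci : ∀ i, Integrable (fun x => cellDeviation w P (π ⁻¹' {i}) x ^ 2) (Measure.pi P) :=
    fun i => integrable_pi_of_abs_le P ((measurable_cellDeviation w P (hπ i)).pow_const 2) (hcb i)
  calc (∫ x, partitionDiscrepancy w P π x ∂Measure.pi P) ^ 2
      ≤ ∫ x, partitionDiscrepancy w P π x ^ 2 ∂Measure.pi P :=
        sq_integral_le_integral_sq (MemLp.of_bound hm.aestronglyMeasurable 2
          (Filter.Eventually.of_forall hb))
    _ ≤ ∫ x, Fintype.card ι * ∑ i, cellDeviation w P (π ⁻¹' {i}) x ^ 2 ∂Measure.pi P := by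
        refine integral_mono_of_nonneg (Filter.Eventually.of_forall fun x => sq_nonneg _)
          ((integrable_finsetSum _ fun i _ => hci i).const_mul _)
          (Filter.Eventually.of_forall fun x => ?_)
        refine (sq_sum_le_card_mul_sum_sq (s := Finset.univ)).trans_eq ?_
        simp [sq_abs, Finset.card_univ]
    _ = Fintype.card ι * ∑ i, ∫ x, cellDeviation w P (π ⁻¹' {i}) x ^ 2 ∂Measure.pi P := by
        rw [integral_const_mul, integral_finsetSum _ fun i _ => hci i]
    _ ≤ Fintype.card ι * ∑ i, ∑ t, w t ^ 2 * (P t).real (π ⁻¹' {i}) := by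
        gcongr with i
        exact integral_cellDeviation_sq_le P (hπ i)
    _ = Fintype.card ι * ∑ t, w t ^ 2 := by
        rw [Finset.sum_comm]
        congr 1
        refine Finset.sum_congr rfl fun t _ => ?_
        rw [← Finset.mul_sum, sum_measureReal_fiber _ hπ, mul_one]

end Discrepancy

/-! ### Dyadic cells and the deviation bound -/

section Dyadic

/-- The choice of the finest level. Level `j` costs `2 ^ (-j)` times the square root of the number
of cells of level `j + 1` times `S`, the reciprocal of the sample size. As `m ≤ 1 / q`, this is at
most `b √S (b / 2) ^ j` with `b = 2 ^ (1 / (2 q))`. As `q < 1 / 2`, this bound grows geometrically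
in `j`, so that the finest level, with `2 ^ K ≈ S ^ (-q)`, dominates the sum. -/
lemma exists_level_bound {q : ℝ} (hq0 : 0 < q) (hq1 : q < 1 / 2) : ∃ C > (0 : ℝ),
    ∀ m : ℕ, q * m ≤ 1 → ∀ S : ℝ, 0 < S → S ≤ 1 → ∃ K : ℕ,
      (1 / 2) ^ K + ∑ j ∈ Finset.range K, (1 / 2 : ℝ) ^ j * √((2 ^ (j + 1)) ^ m * S) ≤
        C * S ^ q := by
  set b : ℝ := 2 ^ (1 / (2 * q)) with hb
  have hb2 : 2 < b := by
    have h1 : (1 : ℝ) < 1 / (2 * q) := by rw [lt_div_iff₀ (by positivity)]; linarith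
    calc (2 : ℝ) = 2 ^ (1 : ℝ) := (Real.rpow_one 2).symm
      _ < b := Real.rpow_lt_rpow_of_exponent_lt one_lt_two h1
  have hb0 : 0 < b := by linarith
  have hr : 0 < b / 2 - 1 := by linarith
  refine ⟨2 * (1 + b / (b / 2 - 1)), by positivity, fun m hm S hS0 hS1 => ?_⟩
  obtain ⟨K, hK1, hK2⟩ := exists_nat_pow_near (Real.one_le_rpow_of_pos_of_le_one_of_nonpos hS0 hS1
    (neg_nonpos.2 hq0.le)) one_lt_two
  refine ⟨K, ?_⟩
  have hsq : ∀ j : ℕ, √((2 ^ (j + 1)) ^ m * S) ≤ b ^ (j + 1) * √S := fun j => by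
    rw [Real.sqrt_mul (by positivity)]
    refine mul_le_mul_of_nonneg_right (Real.sqrt_le_iff.2 ⟨by positivity, ?_⟩) (Real.sqrt_nonneg _)
    have h2m : (2 : ℝ) ^ m ≤ b ^ 2 := by
      rw [hb, ← Real.rpow_natCast, ← Real.rpow_natCast, ← Real.rpow_mul zero_le_two]
      refine Real.rpow_le_rpow_of_exponent_le one_le_two ?_
      have : (m : ℝ) ≤ 1 / q := by rw [le_div_iff₀ hq0]; linarith
      calc (m : ℝ) ≤ 1 / q := this
        _ = 1 / (2 * q) * (2 : ℕ) := by push_cast; field_simp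
    calc ((2 : ℝ) ^ (j + 1)) ^ m = (2 ^ m) ^ (j + 1) := by rw [← pow_mul, ← pow_mul, mul_comm]
      _ ≤ (b ^ 2) ^ (j + 1) := by gcongr
      _ = (b ^ (j + 1)) ^ 2 := by rw [← pow_mul, ← pow_mul, mul_comm]
  have hbK : b ^ K * √S ≤ 1 := by
    have : b ^ K ≤ S ^ (-(1 / 2) : ℝ) :=
      calc b ^ K = ((2 : ℝ) ^ K) ^ (1 / (2 * q)) := by
            rw [hb, ← Real.rpow_natCast, ← Real.rpow_natCast, ← Real.rpow_mul zero_le_two,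
              ← Real.rpow_mul zero_le_two, mul_comm]
        _ ≤ (S ^ (-q)) ^ (1 / (2 * q)) := by gcongr
        _ = S ^ (-(1 / 2) : ℝ) := by
            rw [← Real.rpow_mul hS0.le]; congr 1; field_simp
    calc b ^ K * √S ≤ S ^ (-(1 / 2) : ℝ) * S ^ (1 / 2 : ℝ) := by rw [Real.sqrt_eq_rpow]; gcongr
      _ = 1 := by rw [← Real.rpow_add hS0]; norm_num
  have hgeom : ∑ j ∈ Finset.range K, (b / 2) ^ j ≤ (b / 2) ^ K / (b / 2 - 1) := by
    rw [geom_sum_eq (by linarith)]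
    gcongr
    linarith
  have hsum : ∑ j ∈ Finset.range K, (1 / 2 : ℝ) ^ j * √((2 ^ (j + 1)) ^ m * S) ≤
      b / (b / 2 - 1) * (1 / 2) ^ K :=
    calc ∑ j ∈ Finset.range K, (1 / 2 : ℝ) ^ j * √((2 ^ (j + 1)) ^ m * S)
        ≤ ∑ j ∈ Finset.range K, (1 / 2 : ℝ) ^ j * (b ^ (j + 1) * √S) := by
          gcongr with j; exact hsq j
      _ = b * √S * ∑ j ∈ Finset.range K, (b / 2) ^ j := by
          rw [Finset.mul_sum]
          refine Finset.sum_congr rfl fun j _ => ?_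
          rw [div_pow, div_pow, pow_succ]; ring
      _ ≤ b * √S * ((b / 2) ^ K / (b / 2 - 1)) := by gcongr
      _ = b / (b / 2 - 1) * (1 / 2) ^ K * (b ^ K * √S) := by
          rw [div_pow, div_pow, one_pow]; ring
      _ ≤ b / (b / 2 - 1) * (1 / 2) ^ K := mul_le_of_le_one_right (by positivity) hbK
  have hhalf : (1 / 2 : ℝ) ^ K ≤ 2 * S ^ q := by
    rw [one_div, inv_pow, inv_le_comm₀ (by positivity) (by positivity)]
    rw [Real.rpow_neg hS0.le] at hK2
    rw [mul_inv]
    rw [pow_succ] at hK2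
    linarith
  calc (1 / 2) ^ K + ∑ j ∈ Finset.range K, (1 / 2 : ℝ) ^ j * √((2 ^ (j + 1)) ^ m * S)
      ≤ (1 + b / (b / 2 - 1)) * (1 / 2) ^ K := by linarith
    _ ≤ (1 + b / (b / 2 - 1)) * (2 * S ^ q) := by gcongr
    _ = _ := by ring

/-- A bounded subset of Euclidean space is cut by dyadic cubes into cells. -/
lemma exists_dyadic_cells {m : ℕ} {Ξ : Set (EuclideanSpace ℝ (Fin m))} {R : ℝ} (hR : 0 < R)
    (hΞ : ∀ x y : Ξ, dist x y < R) : ∃ π : ∀ k : ℕ, Ξ → (Fin m → Fin (2 ^ k)),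
      (∀ k i, MeasurableSet (π k ⁻¹' {i})) ∧
      (∀ k x y, π (k + 1) x = π (k + 1) y → π k x = π k y) ∧
      ∀ k x y, π k x = π k y → dist x y ≤ (m + 1) * (2 * R) * (1 / 2) ^ k := by
  rcases isEmpty_or_nonempty Ξ with hE | ⟨⟨x₀⟩⟩
  · exact ⟨fun k x => isEmptyElim x, fun k i => by simp [Set.eq_empty_of_isEmpty],
      fun k x => isEmptyElim x, fun k x => isEmptyElim x⟩
  -- the `i`-th coordinate, rescaled such that its values lie in `(0, 1)`
  set u : Ξ → Fin m → ℝ := fun x i => (x.1 i - x₀.1 i + R) / (2 * R) with hu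
  have hcoord : ∀ (x y : Ξ) i, |x.1 i - y.1 i| ≤ dist x y := fun x y i => by
    have := PiLp.norm_apply_le (x.1 - y.1) i
    rwa [← dist_eq_norm, Real.norm_eq_abs] at this
  have hu0 : ∀ x i, 0 ≤ u x i := fun x i => by
    have := abs_le.1 ((hcoord x x₀ i).trans (hΞ x x₀).le)
    exact div_nonneg (by linarith) (by positivity)
  have hu1 : ∀ x i, u x i < 1 := fun x i => by
    have := abs_lt.1 ((hcoord x x₀ i).trans_lt (hΞ x x₀))
    rw [hu, div_lt_one (by positivity)]
    linarith
  have hum : ∀ i, Measurable fun x => u x i := fun i => by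
    have : Measurable fun x : Ξ => x.1 i := by fun_prop
    exact ((this.sub_const _).add_const _).div_const _
  have hlt : ∀ (k : ℕ) x i, ⌊(2 : ℝ) ^ k * u x i⌋₊ < 2 ^ k := fun k x i => by
    rw [Nat.floor_lt (mul_nonneg (by positivity) (hu0 x i))]
    push_cast
    exact mul_lt_of_lt_one_right (by positivity) (hu1 x i)
  refine ⟨fun k x i => ⟨⌊(2 : ℝ) ^ k * u x i⌋₊, hlt k x i⟩, fun k j => ?_, fun k x y h => ?_,
    fun k x y h => ?_⟩
  · have : (fun x (i : Fin m) => (⟨⌊(2 : ℝ) ^ k * u x i⌋₊, hlt k x i⟩ : Fin (2 ^ k))) ⁻¹' {j} =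
        ⋂ i, {x | ⌊(2 : ℝ) ^ k * u x i⌋₊ = (j i : ℕ)} := by
      ext x
      simp [funext_iff, Fin.ext_iff]
    rw [this]
    exact MeasurableSet.iInter fun i =>
      ((Nat.measurable_floor.comp ((hum i).const_mul _)) (measurableSet_singleton _))
  · funext i
    have hi := congrFun h i
    rw [Fin.mk.injEq] at hi ⊢
    have e : ∀ z, ⌊(2 : ℝ) ^ k * u z i⌋₊ = ⌊(2 : ℝ) ^ (k + 1) * u z i⌋₊ / 2 := fun z => by
      rw [← Nat.floor_div_ofNat]
      congr 1
      rw [pow_succ]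
      ring
    rw [e x, e y, hi]
  · have hi : ∀ i, |x.1 i - y.1 i| ≤ 2 * R * (1 / 2) ^ k := fun i => by
      have hi := congrFun h i
      rw [Fin.mk.injEq] at hi
      have hx1 := Nat.floor_le (mul_nonneg (by positivity : (0 : ℝ) ≤ 2 ^ k) (hu0 x i))
      have hx2 := Nat.lt_floor_add_one ((2 : ℝ) ^ k * u x i)
      have hy1 := Nat.floor_le (mul_nonneg (by positivity : (0 : ℝ) ≤ 2 ^ k) (hu0 y i))
      have hy2 := Nat.lt_floor_add_one ((2 : ℝ) ^ k * u y i)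
      rw [hi] at hx1 hx2
      have hd : |(2 : ℝ) ^ k * u x i - 2 ^ k * u y i| ≤ 1 :=
        abs_le.2 ⟨by linarith, by linarith⟩
      have e : x.1 i - y.1 i =
          2 * R * (1 / 2) ^ k * ((2 : ℝ) ^ k * u x i - 2 ^ k * u y i) := by
        have : ((1 : ℝ) / 2) ^ k * 2 ^ k = 1 := by rw [← mul_pow]; norm_num
        have h1 : x.1 i - y.1 i = 2 * R * (u x i - u y i) := by
          simp only [hu]; field_simp; ring
        rw [h1]
        linear_combination (-(2 * R * (u x i - u y i))) * this
      rw [e, abs_mul, abs_of_nonneg (by positivity : 0 ≤ 2 * R * (1 / 2) ^ k)]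
      exact mul_le_of_le_one_right (by positivity) hd
    rw [Subtype.dist_eq, EuclideanSpace.dist_eq]
    refine Real.sqrt_le_iff.2 ⟨by positivity, ?_⟩
    calc ∑ i, dist (x.1 i) (y.1 i) ^ 2 ≤ ∑ _i : Fin m, (2 * R * (1 / 2) ^ k) ^ 2 := by
          gcongr with i
          rw [Real.dist_eq]; exact hi i
      _ = m * (2 * R * (1 / 2) ^ k) ^ 2 := by simp
      _ ≤ (m + 1) ^ 2 * (2 * R * (1 / 2) ^ k) ^ 2 := by
          gcongr
          nlinarith [(Nat.cast_nonneg m : (0 : ℝ) ≤ m)]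
      _ = _ := by ring

end Dyadic

section Deviation

variable {X : Type*} [MeasurableSpace X] {n : ℕ}

lemma isProbabilityMeasure_sum_smul {w : Fin n → ℝ} (hw : w ∈ stdSimplex ℝ (Fin n))
    (P : Fin n → Measure X) [∀ t, IsProbabilityMeasure (P t)] :
    IsProbabilityMeasure (∑ t, ENNReal.ofReal (w t) • P t) := by
  refine ⟨?_⟩
  rw [Measure.finsetSum_apply]
  simp only [Measure.smul_apply, IsProbabilityMeasure.measure_univ, smul_eq_mul, mul_one]
  rw [← ENNReal.ofReal_sum_of_nonneg fun t _ => hw.1 t, hw.2, ENNReal.ofReal_one]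

lemma isProbabilityMeasure_weightedEmpirical {w : Fin n → ℝ} (hw : w ∈ stdSimplex ℝ (Fin n))
    (x : Fin n → X) : IsProbabilityMeasure (weightedEmpirical w x) :=
  isProbabilityMeasure_sum_smul hw fun t => Measure.dirac (x t)

lemma sum_smul_apply_sub_le {w : Fin n → ℝ} (hw : ∀ t, 0 ≤ w t) (P : Fin n → Measure X)
    [∀ t, IsProbabilityMeasure (P t)] {C : Set X} (hC : MeasurableSet C) (x : Fin n → X) :
    weightedEmpirical w x C - (∑ t, ENNReal.ofReal (w t) • P t) C ≤
      ENNReal.ofReal |cellDeviation w P C x| := by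
  have e : ∀ Q : Fin n → Measure X, (∀ t, IsProbabilityMeasure (Q t)) →
      (∑ t, ENNReal.ofReal (w t) • Q t) C = ENNReal.ofReal (∑ t, w t * (Q t).real C) := by
    intro Q hQ
    rw [Measure.finsetSum_apply, ENNReal.ofReal_sum_of_nonneg
      fun t _ => mul_nonneg (hw t) measureReal_nonneg]
    refine Finset.sum_congr rfl fun t _ => ?_
    rw [ENNReal.ofReal_mul (hw t), ofReal_measureReal, Measure.smul_apply, smul_eq_mul]
  rw [weightedEmpirical, e _ inferInstance, e P inferInstance,
    ← ENNReal.ofReal_sub _ (Finset.sum_nonneg fun t _ => mul_nonneg (hw t) measureReal_nonneg)]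
  refine ENNReal.ofReal_le_ofReal ((le_abs_self _).trans_eq (congrArg _ ?_))
  rw [cellDeviation, ← Finset.sum_sub_distrib]
  refine Finset.sum_congr rfl fun t _ => ?_
  rw [← mul_sub, measureReal_def, Measure.dirac_apply' _ hC]
  by_cases h : x t ∈ C <;> simp [h]

/-- The multi-scale bound on the distance between the weighted empirical distribution of `x` and
the mixture `∑ₜ wₜ Pₜ`, with cells of diameter at most `D 2⁻ᵏ` at level `k`, down to level `K`. -/
noncomputable def multiscaleDiscrepancy {ι : ℕ → Type*} [∀ k, Fintype (ι k)] (w : Fin n → ℝ)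
    (P : Fin n → Measure X) (π : ∀ k, X → ι k) (D : ℝ) (K : ℕ) (x : Fin n → X) : ℝ :=
  D * (1 / 2) ^ K +
    ∑ j ∈ Finset.range K, D * (1 / 2) ^ j * partitionDiscrepancy w P (π (j + 1)) x

lemma wassersteinDist_one_le_multiscaleDiscrepancy [PseudoEMetricSpace X] {ι : ℕ → Type*}
    [∀ k, Fintype (ι k)] {w : Fin n → ℝ} (hw : w ∈ stdSimplex ℝ (Fin n)) (P : Fin n → Measure X)
    [∀ t, IsProbabilityMeasure (P t)] {π : ∀ k, X → ι k}
    (hπ : ∀ k i, MeasurableSet (π k ⁻¹' {i}))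
    (hnest : ∀ k x y, π (k + 1) x = π (k + 1) y → π k x = π k y)
    (hzero : ∀ x y, π 0 x = π 0 y) {D : ℝ} (hD : 0 ≤ D)
    (hδ : ∀ k x y, π k x = π k y → edist x y ≤ ENNReal.ofReal (D * (1 / 2) ^ k)) (K : ℕ)
    (x : Fin n → X) :
    wassersteinDist 1 (weightedEmpirical w x) (∑ t, ENNReal.ofReal (w t) • P t) ≤
      ENNReal.ofReal (multiscaleDiscrepancy w P π D K x) := by
  have := isProbabilityMeasure_weightedEmpirical hw x
  have := isProbabilityMeasure_sum_smul hw P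
  obtain ⟨γ, hγ, hcost⟩ := exists_multiscale_coupling π hπ hnest hzero hδ K
    (weightedEmpirical w x) (∑ t, ENNReal.ofReal (w t) • P t) (by
      rw [IsProbabilityMeasure.measure_univ, IsProbabilityMeasure.measure_univ])
  refine (wassersteinDist_one_le hγ).trans (hcost.trans ?_)
  have hnn : ∀ j, 0 ≤ D * (1 / 2) ^ j * partitionDiscrepancy w P (π (j + 1)) x := fun j =>
    mul_nonneg (by positivity) (partitionDiscrepancy_nonneg _ _ _ _)
  rw [multiscaleDiscrepancy, ENNReal.ofReal_add (by positivity)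
    (Finset.sum_nonneg fun j _ => hnn j), ENNReal.ofReal_sum_of_nonneg fun j _ => hnn j,
    IsProbabilityMeasure.measure_univ, mul_one]
  gcongr with j
  rw [ENNReal.ofReal_mul (by positivity : 0 ≤ D * (1 / 2) ^ j), partitionDiscrepancy,
    ENNReal.ofReal_sum_of_nonneg fun i _ => abs_nonneg _]
  gcongr with i
  exact sum_smul_apply_sub_le hw.1 P (hπ _ _) x

lemma sum_half_pow_le (K : ℕ) : ∑ j ∈ Finset.range K, (1 / 2 : ℝ) ^ j ≤ 2 := by
  rw [geom_sum_eq (by norm_num)]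
  have : (0 : ℝ) ≤ (1 / 2) ^ K := by positivity
  rw [div_le_iff_of_neg (by norm_num)]
  linarith

/-- Concentration of the multi-scale discrepancy around its mean: replacing the `t`-th sample
changes it by at most `4 D wₜ`, so that the bounded differences inequality applies. -/
lemma measure_pi_multiscaleDiscrepancy_ge_le {ι : ℕ → Type*}
    [∀ k, Fintype (ι k)] {w : Fin n → ℝ} (hw : w ∈ stdSimplex ℝ (Fin n)) (P : Fin n → Measure X)
    [∀ t, IsProbabilityMeasure (P t)] {π : ∀ k, X → ι k}
    (hπ : ∀ k i, MeasurableSet (π k ⁻¹' {i})) {D : ℝ} (hD : 0 ≤ D) (K : ℕ) {s : ℝ} (hs : 0 ≤ s) :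
    Measure.pi P {x | D * ((1 / 2) ^ K + ∑ j ∈ Finset.range K,
        (1 / 2) ^ j * √(Fintype.card (ι (j + 1)) * ∑ t, w t ^ 2)) + s ≤
          multiscaleDiscrepancy w P π D K x} ≤
      ENNReal.ofReal (Real.exp (-s ^ 2 / (32 * D ^ 2 * ∑ t, w t ^ 2))) := by
  have hm : ∀ j, Measurable (partitionDiscrepancy w P (π (j + 1))) := fun j =>
    measurable_partitionDiscrepancy w P (hπ _)
  have hb : ∀ j x, |partitionDiscrepancy w P (π (j + 1)) x| ≤ 2 := fun j x => by
    rw [abs_of_nonneg (partitionDiscrepancy_nonneg _ _ _ _)]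
    exact partitionDiscrepancy_le_two hw P (hπ _) x
  have hi : ∀ j, Integrable (partitionDiscrepancy w P (π (j + 1))) (Measure.pi P) := fun j =>
    integrable_pi_of_abs_le P (hm j) (hb j)
  have hM : Measurable (multiscaleDiscrepancy w P π D K) :=
    (Finset.measurable_sum _ fun j _ => (hm j).const_mul _).const_add _
  have hsumabs : ∀ (f : ℕ → ℝ) (B : ℝ), 0 ≤ B → (∀ j, |f j| ≤ B) →
      |∑ j ∈ Finset.range K, D * (1 / 2) ^ j * f j| ≤ D * 2 * B := fun f B hB hf =>
    calc |∑ j ∈ Finset.range K, D * (1 / 2) ^ j * f j|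
        ≤ ∑ j ∈ Finset.range K, D * (1 / 2) ^ j * B := by
          refine (Finset.abs_sum_le_sum_abs _ _).trans (Finset.sum_le_sum fun j _ => ?_)
          rw [abs_mul, abs_of_nonneg (by positivity : 0 ≤ D * (1 / 2) ^ j)]
          gcongr
          exact hf j
      _ = D * (∑ j ∈ Finset.range K, (1 / 2) ^ j) * B := by rw [Finset.mul_sum, Finset.sum_mul]
      _ ≤ D * 2 * B := by gcongr; exact sum_half_pow_le K
  have hB : ∀ x, |multiscaleDiscrepancy w P π D K x| ≤ |D * (1 / 2) ^ K| + D * 2 * 2 := fun x =>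
    (abs_add_le _ _).trans (add_le_add_right (hsumabs _ 2 zero_le_two fun j => hb j x) _)
  have hd : ∀ t x y, |multiscaleDiscrepancy w P π D K (Function.update x t y) -
      multiscaleDiscrepancy w P π D K x| ≤ 4 * D * w t := fun t x y => by
    rw [multiscaleDiscrepancy, multiscaleDiscrepancy, add_sub_add_left_eq_sub,
      ← Finset.sum_sub_distrib]
    simp_rw [← mul_sub]
    refine (hsumabs _ (2 * w t) (mul_nonneg zero_le_two (hw.1 t)) fun j =>
      abs_partitionDiscrepancy_update_sub_le hw.1 P _ t x y).trans_eq ?_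
    ring
  have hmean : ∫ x, multiscaleDiscrepancy w P π D K x ∂Measure.pi P ≤
      D * ((1 / 2) ^ K + ∑ j ∈ Finset.range K,
        (1 / 2) ^ j * √(Fintype.card (ι (j + 1)) * ∑ t, w t ^ 2)) := by
    simp only [multiscaleDiscrepancy]
    rw [integral_add (integrable_const _) (integrable_finsetSum _ fun j _ => (hi j).const_mul _),
      integral_finsetSum _ fun j _ => (hi j).const_mul _]
    simp only [integral_const, probReal_univ, smul_eq_mul, one_mul, integral_const_mul]
    rw [mul_add, Finset.mul_sum]
    refine add_le_add_right (Finset.sum_le_sum fun j _ => ?_) _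
    rw [← mul_assoc]
    exact mul_le_mul_of_nonneg_left (integral_partitionDiscrepancy_le hw P (hπ _)) (by positivity)
  have key := measure_pi_ge_le_of_bounded_differences P hM hB
    (fun t => mul_nonneg (by positivity : 0 ≤ 4 * D) (hw.1 t)) hd hs
  have e : 2 * ∑ t, (4 * D * w t) ^ 2 = 32 * D ^ 2 * ∑ t, w t ^ 2 := by
    simp_rw [mul_pow]
    rw [← Finset.mul_sum]
    ring
  rw [e] at key
  refine (measure_mono fun x hx => ?_).trans key
  exact (add_le_add_left hmean s).trans hx

lemma sum_sq_pos_of_mem_stdSimplex {w : Fin n → ℝ} (hw : w ∈ stdSimplex ℝ (Fin n)) :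
    0 < ∑ t, w t ^ 2 := by
  by_contra h
  have h0 : ∑ t, w t ^ 2 = 0 := le_antisymm (not_lt.1 h) (Finset.sum_nonneg fun t _ => sq_nonneg _)
  have hz : ∀ t, w t = 0 := fun t => pow_eq_zero_iff (two_ne_zero) |>.1
    ((Finset.sum_eq_zero_iff_of_nonneg fun t _ => sq_nonneg (w t)).1 h0 t (Finset.mem_univ t))
  have := hw.2
  simp [hz] at this

lemma sum_sq_le_one_of_mem_stdSimplex {w : Fin n → ℝ} (hw : w ∈ stdSimplex ℝ (Fin n)) :
    ∑ t, w t ^ 2 ≤ 1 := by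
  rw [← hw.2]
  refine Finset.sum_le_sum fun t _ => ?_
  have h1 : w t ≤ 1 := by
    rw [← hw.2]
    exact Finset.single_le_sum (fun s _ => hw.1 s) (Finset.mem_univ t)
  rw [sq]
  exact mul_le_of_le_one_left (hw.1 t) h1

end Deviation

/-- Deviation of the weighted empirical distribution of an independent, not identically
distributed sample from the mixture of its laws. The constants depend only on the dimension, the
exponent and a bound on the diameter. -/
theorem exists_measure_pi_wassersteinDist_ge_le (m : ℕ) {q R : ℝ} (hq0 : 0 < q) (hq1 : q < 1 / 2)
    (hqm : q * m ≤ 1) (hR : 0 < R) : ∃ C > (0 : ℝ), ∃ D > (0 : ℝ),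
    ∀ Ξ : Set (EuclideanSpace ℝ (Fin m)), (∀ x y : Ξ, dist x y < R) →
    ∀ (n : ℕ) (w : Fin n → ℝ), w ∈ stdSimplex ℝ (Fin n) →
    ∀ P : Fin n → Measure Ξ, (∀ t, IsProbabilityMeasure (P t)) → ∀ s : ℝ, 0 ≤ s →
      Measure.pi P {x | ENNReal.ofReal (C * (∑ t, w t ^ 2) ^ q + s) ≤
        wassersteinDist 1 (weightedEmpirical w x) (∑ t, ENNReal.ofReal (w t) • P t)} ≤
      ENNReal.ofReal (Real.exp (-s ^ 2 / (D * ∑ t, w t ^ 2))) := by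
  obtain ⟨C, hC, hlevel⟩ := exists_level_bound hq0 hq1
  have hE : (0 : ℝ) < (m + 1) * (2 * R) := by positivity
  refine ⟨(m + 1) * (2 * R) * C, by positivity, 32 * ((m + 1) * (2 * R)) ^ 2, by positivity,
    fun Ξ hΞ n w hw P hP s hs => ?_⟩
  have hS0 := sum_sq_pos_of_mem_stdSimplex hw
  obtain ⟨K, hK⟩ := hlevel m hqm _ hS0 (sum_sq_le_one_of_mem_stdSimplex hw)
  obtain ⟨π, hπ, hnest, hdiam⟩ := exists_dyadic_cells hR hΞ
  refine (measure_mono fun x hx => ?_).trans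
    (measure_pi_multiscaleDiscrepancy_ge_le hw P hπ hE.le K hs)
  have hzero : ∀ x y, π 0 x = π 0 y := fun x y => funext fun i =>
    Fin.ext (by have := (π 0 x i).2; have := (π 0 y i).2; omega)
  have hle := hx.trans (wassersteinDist_one_le_multiscaleDiscrepancy hw P hπ hnest hzero hE.le
    (fun k x y h => by rw [edist_dist]; exact ENNReal.ofReal_le_ofReal (hdiam k x y h)) K x)
  have hpos : 0 < (m + 1) * (2 * R) * C * (∑ t, w t ^ 2) ^ q + s := by positivity
  have hle' := (ENNReal.ofReal_le_ofReal_iff' .. |>.1 hle).resolve_right (not_le.2 hpos)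
  refine le_trans ?_ hle'
  rw [mul_assoc _ C]
  refine add_le_add_left (mul_le_mul_of_nonneg_left (le_trans (le_of_eq ?_) hK) hE.le) s
  simp

/-! ### Optimal weightings -/

section OptimalWeights

variable {T : ℕ}

lemma one_le_lookBack (t : Fin T) : 1 ≤ lookBack t := by
  have : ((t : ℕ) : ℝ) + 1 ≤ T := by exact_mod_cast t.2
  rw [lookBack]; linarith

lemma sum_lookBack (g : ℝ → ℝ) : ∑ t : Fin T, g (lookBack t) = ∑ i ∈ Finset.range T, g (i + 1) := by
  rw [← Finset.sum_range_reflect, ← Fin.sum_univ_eq_sum_range (fun i => g ((T - 1 - i : ℕ) + 1))]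
  refine Finset.sum_congr rfl fun t _ => congrArg g ?_
  have e : (T - 1 - (t : ℕ)) + 1 + t = T := by omega
  have e' : (((T - 1 - (t : ℕ) : ℕ) : ℝ)) + 1 + (t : ℕ) = T := by exact_mod_cast e
  rw [lookBack]; linarith

lemma weightedDrift_one (w : Fin T → ℝ) : weightedDrift 1 w = ∑ t, w t * lookBack t := by
  simp [weightedDrift]

lemma sub_weightedDrift_one_mul {w : Fin T → ℝ} (hw : w ∈ stdSimplex ℝ (Fin T)) (ρ ε : ℝ) :
    ε - weightedDrift 1 w * ρ = ∑ t, w t * (ε - ρ * lookBack t) := by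
  simp_rw [mul_sub, Finset.sum_sub_distrib]
  rw [← Finset.sum_mul, hw.2, one_mul, weightedDrift_one, Finset.sum_mul]
  congr 1
  exact Finset.sum_congr rfl fun t _ => by ring

lemma optimalWeighting_objective_eq {w : Fin T → ℝ} (hw : w ∈ stdSimplex ℝ (Fin T)) (ρ ε : ℝ) :
    effectiveSampleSize w * max 0 (ε - weightedDrift 1 w * ρ) ^ (2 * 1 : ℝ) =
      max 0 (∑ t, w t * (ε - ρ * lookBack t)) ^ 2 / ∑ t, w t ^ 2 := by
  rw [sub_weightedDrift_one_mul hw, effectiveSampleSize, mul_one, Real.rpow_two]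
  ring

variable {ρ ε : ℝ}

lemma sum_max_pos (hT : 0 < T) (hε : ρ < ε) :
    0 < ∑ t : Fin T, max 0 (ε - ρ * lookBack t) := by
  refine Finset.sum_pos' (fun t _ => le_max_left _ _) ⟨⟨T - 1, by omega⟩, Finset.mem_univ _, ?_⟩
  have : lookBack (⟨T - 1, by omega⟩ : Fin T) = 1 := by
    rw [lookBack, Nat.cast_sub hT]; simp
  rw [this]
  exact lt_max_of_lt_right (by linarith)

lemma triangularWeights_mem_stdSimplex (hT : 0 < T) (hε : ρ < ε) :
    triangularWeights T ρ ε ∈ stdSimplex ℝ (Fin T) := by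
  refine ⟨fun t => div_nonneg (le_max_left _ _) (sum_max_pos hT hε).le, ?_⟩
  simp only [triangularWeights]
  rw [← Finset.sum_div, div_self (sum_max_pos hT hε).ne']

lemma max_mul_self_eq (a : ℝ) : max 0 a * a = max 0 a ^ 2 := by
  rcases le_total 0 a with h | h
  · rw [max_eq_right h, sq]
  · simp [max_eq_left h]

lemma sum_triangularWeights_mul : ∑ t, triangularWeights T ρ ε t * (ε - ρ * lookBack t) =
    (∑ t : Fin T, max 0 (ε - ρ * lookBack t) ^ 2) / ∑ t : Fin T, max 0 (ε - ρ * lookBack t) := by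
  rw [Finset.sum_div]
  refine Finset.sum_congr rfl fun t _ => ?_
  rw [triangularWeights, div_mul_eq_mul_div, max_mul_self_eq]

lemma sum_triangularWeights_sq : ∑ t, triangularWeights T ρ ε t ^ 2 =
    (∑ t : Fin T, max 0 (ε - ρ * lookBack t) ^ 2) /
      (∑ t : Fin T, max 0 (ε - ρ * lookBack t)) ^ 2 := by
  rw [Finset.sum_div]
  exact Finset.sum_congr rfl fun t _ => by rw [triangularWeights, div_pow]

lemma sum_mul_le_sum_mul_max {w : Fin T → ℝ} (hw : w ∈ stdSimplex ℝ (Fin T)) :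
    max 0 (∑ t, w t * (ε - ρ * lookBack t)) ≤ ∑ t, w t * max 0 (ε - ρ * lookBack t) :=
  max_le (Finset.sum_nonneg fun t _ => mul_nonneg (hw.1 t) (le_max_left _ _))
    (Finset.sum_le_sum fun t _ => mul_le_mul_of_nonneg_left (le_max_right _ _) (hw.1 t))

lemma sum_max_sq_pos (hT : 0 < T) (hε : ρ < ε) :
    0 < ∑ t : Fin T, max 0 (ε - ρ * lookBack t) ^ 2 := by
  have h := sum_sq_pos_of_mem_stdSimplex (triangularWeights_mem_stdSimplex hT hε)
  rw [sum_triangularWeights_sq] at h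
  exact (div_pos_iff_of_pos_right (pow_pos (sum_max_pos hT hε) 2)).1 h

lemma optimalWeighting_objective_triangularWeights (hT : 0 < T) (hε : ρ < ε) :
    effectiveSampleSize (triangularWeights T ρ ε) *
      max 0 (ε - weightedDrift 1 (triangularWeights T ρ ε) * ρ) ^ (2 * 1 : ℝ) =
      ∑ t : Fin T, max 0 (ε - ρ * lookBack t) ^ 2 := by
  have h1 := sum_max_pos hT hε
  have h2 := sum_max_sq_pos hT hε
  rw [optimalWeighting_objective_eq (triangularWeights_mem_stdSimplex hT hε),
    sum_triangularWeights_mul, sum_triangularWeights_sq, max_eq_right (by positivity)]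
  field_simp

/-- The triangular weighting is optimal: by the Cauchy–Schwarz inequality the objective is at most
`∑ₜ (ε - ρ (T - t + 1))₊²`. -/
lemma isOptimalWeighting_triangularWeights (hT : 0 < T) (hε : ρ < ε) :
    IsOptimalWeighting 1 ρ ε (triangularWeights T ρ ε) := by
  refine ⟨triangularWeights_mem_stdSimplex hT hε, fun v hv => ?_⟩
  simp only [Set.mem_ofPred_eq]
  rw [optimalWeighting_objective_triangularWeights hT hε, optimalWeighting_objective_eq hv,
    div_le_iff₀ (sum_sq_pos_of_mem_stdSimplex hv), mul_comm]
  calc max 0 (∑ t, v t * (ε - ρ * lookBack t)) ^ 2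
      ≤ (∑ t, v t * max 0 (ε - ρ * lookBack t)) ^ 2 := by
        gcongr; exact sum_mul_le_sum_mul_max hv
    _ ≤ _ := Finset.sum_mul_sq_le_sq_mul_sq _ _ _

/-- An optimal weighting attains equality in the Cauchy–Schwarz inequality, hence is proportional
to `(ε - ρ (T - t + 1))₊`. -/
lemma IsOptimalWeighting.eq_triangularWeights (hT : 0 < T) (hε : ρ < ε) {w : Fin T → ℝ}
    (h : IsOptimalWeighting 1 ρ ε w) : w = triangularWeights T ρ ε := by
  obtain ⟨hw, hmax⟩ := h
  have h1 := sum_max_pos hT hε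
  have h2 := sum_max_sq_pos hT hε
  have hle := hmax (triangularWeights_mem_stdSimplex hT hε)
  simp only [Set.mem_ofPred_eq] at hle
  rw [optimalWeighting_objective_triangularWeights hT hε, optimalWeighting_objective_eq hw,
    le_div_iff₀ (sum_sq_pos_of_mem_stdSimplex hw)] at hle
  set u : Fin T → ℝ := fun t => max 0 (ε - ρ * lookBack t) with hu
  set A := ∑ t, u t ^ 2 with hA
  set B := ∑ t, w t * u t with hB
  have hcs : A * ∑ t, w t ^ 2 ≤ B ^ 2 := hle.trans (by gcongr; exact sum_mul_le_sum_mul_max hw)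
  have hexp : ∑ t, (A * w t - B * u t) ^ 2 = A * (A * ∑ t, w t ^ 2 - B ^ 2) := by
    have e : ∀ t, (A * w t - B * u t) ^ 2 =
        A ^ 2 * w t ^ 2 - 2 * A * B * (w t * u t) + B ^ 2 * u t ^ 2 := fun t => by ring
    simp_rw [e]
    rw [Finset.sum_add_distrib, Finset.sum_sub_distrib, ← Finset.mul_sum, ← Finset.mul_sum,
      ← Finset.mul_sum, ← hA, ← hB]
    ring
  have hzero : ∑ t, (A * w t - B * u t) ^ 2 = 0 :=
    le_antisymm (by rw [hexp]; exact mul_nonpos_of_nonneg_of_nonpos h2.le (by linarith))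
      (Finset.sum_nonneg fun t _ => sq_nonneg _)
  have hprop : ∀ t, A * w t = B * u t := fun t => sub_eq_zero.1 (pow_eq_zero_iff two_ne_zero |>.1
    ((Finset.sum_eq_zero_iff_of_nonneg fun t _ => sq_nonneg _).1 hzero t (Finset.mem_univ t)))
  have hAB : A = B * ∑ t, u t := by
    have := Finset.sum_congr (rfl : (Finset.univ : Finset (Fin T)) = _) fun t _ => hprop t
    rwa [← Finset.mul_sum, ← Finset.mul_sum, hw.2, mul_one] at this
  funext t
  change w t = u t / ∑ s, u s
  rw [eq_div_iff h1.ne']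
  have hB0 : B ≠ 0 := fun h0 => h2.ne' (by rw [hAB, h0, zero_mul])
  refine mul_left_cancel₀ hB0 ?_
  calc B * (w t * ∑ s, u s) = (B * ∑ s, u s) * w t := by ring
    _ = B * u t := by rw [← hAB, hprop]

/-- If the horizon is at least `N` and the radius at least `2 (N + 1) ρ`, then the triangular
weighting has an effective sample size of at least `N / 2`, and the drift uses up at most a fixed
fraction of the radius. Both follow by counting: with `M = min T ⌊ε / (2 ρ)⌋`, at least `M` of the
numbers `(ε - ρ i)₊` are at least `ε / 2`, and at most `4 M` of them are positive. -/
lemma triangularWeights_bounds (hρ : 0 < ρ) {N : ℝ} (hN : 0 < N) (hT : N ≤ T)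
    (hε : 2 * ρ * (N + 1) ≤ ε) :
    ∑ t, triangularWeights T ρ ε t ^ 2 ≤ 2 / N ∧
      ε / 8 ≤ ε - weightedDrift 1 (triangularWeights T ρ ε) * ρ := by
  have hT0 : 0 < T := by exact_mod_cast hN.trans_le hT
  have hρN : 0 < ρ * N := mul_pos hρ hN
  have hερ : ρ < ε := by linarith
  have hε0 : 0 < ε := hρ.trans hερ
  set a := ε / (2 * ρ) with ha
  have haε : ε = 2 * ρ * a := by rw [ha]; field_simp
  have haN : N + 1 ≤ a := by rw [ha, le_div_iff₀ (by positivity)]; linarith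
  set M := min T ⌊a⌋₊ with hM
  have hfl : (⌊a⌋₊ : ℝ) ≤ a := Nat.floor_le (by linarith)
  have hfl' : a < ⌊a⌋₊ + 1 := Nat.lt_floor_add_one a
  have hf1 : (1 : ℝ) ≤ ⌊a⌋₊ := by
    have : 1 ≤ ⌊a⌋₊ := Nat.le_floor (by push_cast; linarith)
    exact_mod_cast this
  have hMN : N ≤ M := by rw [hM, Nat.cast_min]; exact le_min hT (by linarith)
  have hM0 : (0 : ℝ) < M := hN.trans_le hMN
  set u : ℝ → ℝ := fun x => max 0 (ε - ρ * x) with hu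
  have hu0 : ∀ x, 0 ≤ u x := fun x => le_max_left _ _
  have hU1 := sum_max_pos hT0 hερ
  have hU2 := sum_max_sq_pos hT0 hερ
  rw [sub_weightedDrift_one_mul (triangularWeights_mem_stdSimplex hT0 hερ),
    sum_triangularWeights_mul, sum_triangularWeights_sq]
  rw [sum_lookBack u] at hU1 ⊢
  rw [sum_lookBack fun x => u x ^ 2] at hU2 ⊢
  set U1 := ∑ i ∈ Finset.range T, u (i + 1)
  set U2 := ∑ i ∈ Finset.range T, u (i + 1) ^ 2
  have hlow : M * (ε / 2) ≤ U1 :=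
    calc M * (ε / 2) = ∑ _i ∈ Finset.range M, ε / 2 := by simp
      _ ≤ ∑ i ∈ Finset.range M, u (i + 1) := by
        refine Finset.sum_le_sum fun i hi => le_max_of_le_right ?_
        have hi' : ((i : ℕ) : ℝ) + 1 ≤ M := by exact_mod_cast Finset.mem_range.1 hi
        have : ((i : ℕ) : ℝ) + 1 ≤ a :=
          (hi'.trans (by exact_mod_cast min_le_right _ _)).trans hfl
        have := mul_le_mul_of_nonneg_left this hρ.le
        rw [haε]
        linarith
      _ ≤ U1 := Finset.sum_le_sum_of_subset_of_nonneg
        (Finset.range_mono (min_le_left _ _)) fun i _ _ => hu0 _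
  have hsupp : ∀ i ∈ Finset.range T, i ∉ (Finset.range T).filter (· < 4 * M) → u (i + 1) = 0 := by
    intro i hi hi'
    rw [Finset.mem_filter, not_and, not_lt] at hi'
    have h4 := hi' hi
    have hiT := Finset.mem_range.1 hi
    have hMT : M = ⌊a⌋₊ := by
      rcases min_choice T ⌊a⌋₊ with h | h <;> omega
    have h4' : 4 * (⌊a⌋₊ : ℝ) ≤ i := by rw [← hMT]; exact_mod_cast h4
    refine max_eq_left ?_
    have : 2 * a ≤ (i : ℝ) + 1 := by linarith
    have := mul_le_mul_of_nonneg_left this hρ.le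
    rw [haε]
    linarith
  have hcs : U1 ^ 2 ≤ 4 * M * U2 :=
    calc U1 ^ 2 = (∑ i ∈ (Finset.range T).filter (· < 4 * M), u (i + 1)) ^ 2 := by
          rw [Finset.sum_subset (Finset.filter_subset _ _) hsupp]
      _ ≤ ((Finset.range T).filter (· < 4 * M)).card *
            ∑ i ∈ (Finset.range T).filter (· < 4 * M), u (i + 1) ^ 2 :=
          sq_sum_le_card_mul_sum_sq
      _ ≤ 4 * M * U2 := by
          refine mul_le_mul ?_ (Finset.sum_le_sum_of_subset_of_nonneg (Finset.filter_subset _ _)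
            fun i _ _ => sq_nonneg _) (Finset.sum_nonneg fun i _ => sq_nonneg _) (by positivity)
          have : ((Finset.range T).filter (· < 4 * M)).card ≤ (Finset.range (4 * M)).card :=
            Finset.card_le_card fun i hi => Finset.mem_range.2 (Finset.mem_filter.1 hi).2
          rw [Finset.card_range] at this
          exact_mod_cast this
  have hU21 : U2 ≤ ε * U1 := by
    rw [Finset.mul_sum]
    refine Finset.sum_le_sum fun i _ => ?_
    rw [sq]
    refine mul_le_mul_of_nonneg_right (max_le hε0.le ?_) (hu0 _)
    have : 0 ≤ ρ * ((i : ℝ) + 1) := by positivity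
    linarith
  constructor
  · rw [div_le_div_iff₀ (by positivity) hN]
    have h1 : N * (ε / 2) ≤ U1 := (mul_le_mul_of_nonneg_right hMN (by positivity)).trans hlow
    calc U2 * N ≤ ε * U1 * N := by gcongr
      _ = 2 * (N * (ε / 2)) * U1 := by ring
      _ ≤ 2 * U1 * U1 := by gcongr
      _ = 2 * U1 ^ 2 := by ring
  · rw [le_div_iff₀ hU1]
    have h1 : M * (ε / 2) * U1 ≤ U1 ^ 2 := by rw [sq]; gcongr
    have h2 : (M : ℝ) * (ε / 8 * U1) ≤ M * U2 := by linarith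
    exact le_of_mul_le_mul_left h2 hM0

end OptimalWeights

/-! ### Confidence of the triangular weighting -/

section Confidence

/-- The distance from the mixture of the past laws to the present law is at most the weighted
drift. -/
lemma wassersteinDist_one_mixture_last_le {X : Type*} [PseudoEMetricSpace X] [MeasurableSpace X]
    [OpensMeasurableSpace X] [SecondCountableTopology X] [StandardBorelSpace X] [Nonempty X]
    {T : ℕ} {P : Fin (T + 1) → Measure X} (hP : ∀ t, IsProbabilityMeasure (P t)) {ρ : ℝ}
    (hρ : 0 ≤ ρ) (h : ∀ t : Fin T, wassersteinInfDist (P t.castSucc) (P t.succ) ≤ ENNReal.ofReal ρ)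
    {w : Fin T → ℝ} (hw : w ∈ stdSimplex ℝ (Fin T)) :
    wassersteinDist 1 (∑ t, ENNReal.ofReal (w t) • P t.castSucc) (P (Fin.last T)) ≤
      ENNReal.ofReal (weightedDrift 1 w * ρ) := by
  have hlast : P (Fin.last T) = ∑ t, ENNReal.ofReal (w t) • P (Fin.last T) := by
    rw [← Finset.sum_smul, ← ENNReal.ofReal_sum_of_nonneg fun t _ => hw.1 t, hw.2,
      ENNReal.ofReal_one, one_smul]
  have hnn : ∀ t, 0 ≤ w t * lookBack t * ρ := fun t =>
    mul_nonneg (mul_nonneg (hw.1 t) (zero_le_one.trans (one_le_lookBack t))) hρ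
  rw [hlast, weightedDrift_one, Finset.sum_mul, ENNReal.ofReal_sum_of_nonneg fun t _ => hnn t]
  refine (wassersteinDist_one_sum_le _ (fun _ => ENNReal.ofReal_ne_top) _ _).trans
    (Finset.sum_le_sum fun t _ => ?_)
  rw [mul_assoc, ENNReal.ofReal_mul (hw.1 t)]
  gcongr
  refine (wassersteinDist_one_last_le hP h _).trans_eq ?_
  rw [ENNReal.ofReal_mul (zero_le_one.trans (one_le_lookBack t))]
  congr 1
  rw [Fin.val_castSucc, lookBack, ← Nat.cast_sub t.2.le, ENNReal.ofReal_natCast]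

variable {Ω X : Type*} [MeasurableSpace Ω] [MeasurableSpace X] {n : ℕ}

lemma measure_comp_le_measure_pi {μ : Measure Ω} [IsProbabilityMeasure μ] {ξ : Fin n → Ω → X}
    {P : Fin n → Measure X} (hind : iIndepFun ξ μ) (hlaw : ∀ t, HasLaw (ξ t) (P t) μ)
    (A : Set (Fin n → X)) : μ {ω | (fun t => ξ t ω) ∈ A} ≤ Measure.pi P A := by
  have hm : ∀ t, AEMeasurable (ξ t) μ := fun t => (hlaw t).aemeasurable
  have hpi := hind.map_fun_eq_pi_map hm
  simp_rw [fun t => (hlaw t).map_eq] at hpi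
  rw [← hpi]
  exact Measure.le_map_apply (aemeasurable_pi_lambda _ hm) A

/-- Transfer of a deviation bound for the mixture of the past laws to the present law: the drift
enters additively, by the triangle inequality. -/
lemma measure_wassersteinDist_last_ge_le {Ω X : Type*} [MeasurableSpace Ω] [PseudoEMetricSpace X]
    [MeasurableSpace X] [OpensMeasurableSpace X] [SecondCountableTopology X]
    [StandardBorelSpace X] [Nonempty X] {T : ℕ} {P : Fin (T + 1) → Measure X}
    (hP : ∀ t, IsProbabilityMeasure (P t)) {ρ : ℝ} (hρ : 0 ≤ ρ)
    (h : ∀ t : Fin T, wassersteinInfDist (P t.castSucc) (P t.succ) ≤ ENNReal.ofReal ρ)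
    {w : Fin T → ℝ} (hw : w ∈ stdSimplex ℝ (Fin T)) {μ : Measure Ω} [IsProbabilityMeasure μ]
    {ξ : Fin T → Ω → X} (hind : iIndepFun ξ μ) (hlaw : ∀ t, HasLaw (ξ t) (P t.castSucc) μ)
    {a : ℝ} (ha : 0 ≤ a) :
    μ {ω | ENNReal.ofReal (a + weightedDrift 1 w * ρ) ≤
        wassersteinDist 1 (weightedEmpirical w (fun t => ξ t ω)) (P (Fin.last T))} ≤
      Measure.pi (fun t : Fin T => P t.castSucc) {x | ENNReal.ofReal a ≤
        wassersteinDist 1 (weightedEmpirical w x) (∑ t, ENNReal.ofReal (w t) • P t.castSucc)} := by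
  refine le_trans (measure_mono fun ω hω => ?_) (measure_comp_le_measure_pi hind hlaw _)
  have hprob := isProbabilityMeasure_weightedEmpirical hw fun t => ξ t ω
  have hmix := isProbabilityMeasure_sum_smul hw fun t : Fin T => P t.castSucc
  have hd : 0 ≤ weightedDrift 1 w * ρ := by
    refine mul_nonneg ?_ hρ
    rw [weightedDrift_one]
    exact Finset.sum_nonneg fun t _ => mul_nonneg (hw.1 t) (zero_le_one.trans (one_le_lookBack t))
  have htri := hω.trans ((wassersteinDist_one_triangle _
    (∑ t, ENNReal.ofReal (w t) • P t.castSucc) _).trans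
      (add_le_add_right (wassersteinDist_one_mixture_last_le hP hρ h hw) _))
  rw [ENNReal.ofReal_add ha hd] at htri
  exact (ENNReal.add_le_add_iff_right ENNReal.ofReal_ne_top).1 htri

/-- The two terms of the radius in the small-drift regime, in terms of the quantity `N` which bounds
the horizon `T` from below. -/
lemma confidenceRadius_terms_eq {K L ρ q N : ℝ} (hK : 0 < K) (hL : 0 < L) (hρ : 0 < ρ)
    (hN : N = (12 / (12 * K ^ 3) * ρ ^ (-2 : ℝ) * L) ^ (1 / 3 : ℝ)) :
    0 < N ∧ K ^ 3 * (N ^ 3 * ρ ^ 2) = L ∧ (ρ * L) ^ (1 / 3 : ℝ) = K * N * ρ ∧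
      (ρ ^ (2 * q) * L ^ (-q)) ^ (1 / 3 : ℝ) = K ^ (-q) * N ^ (-q) := by
  have hρ2 : ρ ^ (-2 : ℝ) = (ρ ^ 2)⁻¹ := by rw [Real.rpow_neg hρ.le, Real.rpow_two]
  have hN0 : 0 < N := by rw [hN]; positivity
  have hcube : ∀ x : ℝ, 0 ≤ x → (x ^ (1 / 3 : ℝ)) ^ 3 = x := fun x hx => by
    rw [← Real.rpow_natCast, ← Real.rpow_mul hx]; norm_num
  have hroot : ∀ x : ℝ, 0 ≤ x → (x ^ 3) ^ (1 / 3 : ℝ) = x := fun x hx => by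
    rw [← Real.rpow_natCast, ← Real.rpow_mul hx]; norm_num
  have hN3 : N ^ 3 = 12 / (12 * K ^ 3) * ρ ^ (-2 : ℝ) * L := by
    rw [hN]; exact hcube _ (by positivity)
  have hL' : K ^ 3 * (N ^ 3 * ρ ^ 2) = L := by rw [hN3, hρ2]; field_simp
  refine ⟨hN0, hL', ?_, ?_⟩
  · rw [← hL', ← hroot (K * N * ρ) (by positivity)]
    congr 1; ring
  · have e : ρ ^ (2 * q) * L ^ (-q) = ((K * N) ^ (-q)) ^ 3 := by
      have h1 : ρ ^ (2 * q) = (ρ ^ 2) ^ q := by rw [Real.rpow_mul hρ.le, Real.rpow_two]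
      have h2 : L = ρ ^ 2 * (K * N) ^ 3 := by rw [← hL']; ring
      have h3 : ((K * N) ^ 3) ^ (-q) = ((K * N) ^ (-q)) ^ 3 := by
        rw [← Real.rpow_natCast, ← Real.rpow_natCast, ← Real.rpow_mul (by positivity),
          ← Real.rpow_mul (by positivity), mul_comm (-q)]
      rw [h1, h2, Real.mul_rpow (by positivity) (by positivity), h3, ← mul_assoc,
        ← Real.rpow_add (by positivity), add_neg_cancel, Real.rpow_zero, one_mul]
    rw [e, hroot _ (by positivity), Real.mul_rpow hK.le hN0.le]

/-- An eighth of the second term of the radius absorbs the mean deviation `C S ^ q`. -/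
lemma mul_rpow_le_second_term {C K N S q : ℝ} (hq0 : 0 < q) (hq1 : q < 1 / 2) (hC : 0 < C)
    (hK : K = 1 + 2 * C) (hN0 : 0 < N) (hS0 : 0 < S) (hS : S ≤ 2 / N) :
    C * S ^ q ≤ 12 * K ^ 3 * (K ^ (-q) * N ^ (-q)) / 8 := by
  have hK1 : 1 ≤ K := by linarith
  have hK0 : 0 < K := by linarith
  have h1 : S ^ q ≤ 2 * N ^ (-q) :=
    calc S ^ q ≤ (2 / N) ^ q := by gcongr
      _ = 2 ^ q * N ^ (-q) := by
        rw [Real.div_rpow zero_le_two hN0.le, Real.rpow_neg hN0.le, div_eq_mul_inv]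
      _ ≤ 2 ^ (1 : ℝ) * N ^ (-q) := by
        gcongr
        · exact one_le_two
        · linarith
      _ = 2 * N ^ (-q) := by rw [Real.rpow_one]
  have h2 : K ≤ K ^ 3 * K ^ (-q) :=
    calc K = K ^ (1 : ℝ) := (Real.rpow_one K).symm
      _ ≤ K ^ ((3 : ℕ) + -q : ℝ) :=
        Real.rpow_le_rpow_of_exponent_le hK1 (by push_cast; linarith)
      _ = K ^ 3 * K ^ (-q) := by rw [Real.rpow_add hK0, Real.rpow_natCast]
  have h3 : 0 < N ^ (-q) := by positivity
  calc C * S ^ q ≤ C * (2 * N ^ (-q)) := by gcongr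
    _ ≤ K * N ^ (-q) := by nlinarith
    _ ≤ K ^ 3 * K ^ (-q) * N ^ (-q) := by gcongr
    _ ≤ 12 * K ^ 3 * (K ^ (-q) * N ^ (-q)) / 8 := by
      have : 0 < K ^ 3 * K ^ (-q) * N ^ (-q) := by positivity
      linarith

/-- An eighth of the first term of the radius absorbs the fluctuations at confidence `exp (-L)`. -/
lemma mul_le_sq_first_term {D K N S L ρ c₁ : ℝ} (hD : 0 < D) (hK0 : 0 < K) (hN0 : 0 < N)
    (hρ : 0 < ρ) (hS : S ≤ 2 / N) (hc₁ : c₁ = 4 + 128 * D * K)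
    (hNL : K ^ 3 * (N ^ 3 * ρ ^ 2) = L) : L * (D * S) ≤ (c₁ * (K * N * ρ) / 8) ^ 2 := by
  have hDK : 0 < D * K := mul_pos hD hK0
  have hL : 0 < L := by rw [← hNL]; positivity
  calc L * (D * S) ≤ L * (D * (2 / N)) := by gcongr
    _ = 128 * D * K * (K * N * ρ) ^ 2 / 64 := by rw [← hNL]; field_simp; ring
    _ ≤ c₁ ^ 2 * (K * N * ρ) ^ 2 / 64 := by gcongr; rw [hc₁]; nlinarith
    _ = (c₁ * (K * N * ρ) / 8) ^ 2 := by ring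

/-- In the small-drift regime the quantity `N` exceeds one. -/
lemma one_lt_of_lt_driftThreshold {K β ρ : ℝ} (hK0 : 0 < K) (hL : 0 < Real.log (1 / β))
    (hρ : 0 < ρ) (h : ρ < driftThreshold (12 * K ^ 3) β) :
    1 < (12 / (12 * K ^ 3) * ρ ^ (-2 : ℝ) * Real.log (1 / β)) ^ (1 / 3 : ℝ) := by
  have h1 : ρ ^ 2 < 12 / (12 * K ^ 3) * Real.log (1 / β) := by
    have h2 := pow_lt_pow_left₀ h hρ.le two_ne_zero
    rwa [driftThreshold, ← Real.rpow_natCast (_ ^ _), ← Real.rpow_mul (by positivity),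
      show (1 / 2 : ℝ) * (2 : ℕ) = 1 by norm_num, Real.rpow_one] at h2
  refine Real.one_lt_rpow ?_ (by norm_num)
  rw [Real.rpow_neg hρ.le, Real.rpow_two, mul_right_comm, ← div_eq_mul_inv,
    lt_div_iff₀ (by positivity), one_mul]
  exact h1

end Confidence

theorem mainTheorem7 (m : ℕ) (Δ q : ℝ) (hq0 : 0 < q) (hq1 : q < 1 / 2) (hqm : q * m ≤ 1) :
    ∃ c₁ > (0 : ℝ), ∃ c₂ > (0 : ℝ), ∀ β₀ : ℝ, 0 < β₀ → β₀ ≤ 1 →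
    ∃ c₃ > (0 : ℝ), ∃ c₄ ≥ (0 : ℝ), (β₀ < 1 → c₄ = 0) ∧
    ∀ Ξ : Set (EuclideanSpace ℝ (Fin m)), IsClosed Ξ → Bornology.IsBounded Ξ → Metric.diam Ξ ≤ Δ →
    ∀ β : ℝ, 0 < β → β < β₀ → ∀ ρ : ℝ, 0 < ρ →
    ∀ T : ℕ, (12 / c₂ * ρ ^ (-2 : ℝ) * Real.log (1 / β)) ^ (1 / 3 : ℝ) ≤ (T : ℝ) →
      (∃ w : Fin T → ℝ, IsOptimalWeighting 1 ρ (confidenceRadius c₁ c₂ c₃ c₄ q β ρ) w) ∧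
      ∀ w : Fin T → ℝ, IsOptimalWeighting 1 ρ (confidenceRadius c₁ c₂ c₃ c₄ q β ρ) w →
        w = triangularWeights T ρ (confidenceRadius c₁ c₂ c₃ c₄ q β ρ) ∧
        ∀ P : Fin (T + 1) → Measure Ξ, (∀ t, IsProbabilityMeasure (P t)) →
        (∀ t : Fin T, wassersteinInfDist (P t.castSucc) (P t.succ) ≤ ENNReal.ofReal ρ) →
        ∀ (Ω : Type*) [MeasurableSpace Ω] (μ : Measure Ω) [IsProbabilityMeasure μ]
          (ξ : Fin T → Ω → Ξ), iIndepFun ξ μ → (∀ t, HasLaw (ξ t) (P t.castSucc) μ) →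
          μ {ω | ENNReal.ofReal (confidenceRadius c₁ c₂ c₃ c₄ q β ρ) ≤
              wassersteinDist 1 (weightedEmpirical w (fun t => ξ t ω)) (P (Fin.last T))}
            ≤ ENNReal.ofReal β := by
  have hR : 0 < |Δ| + 1 := by positivity
  obtain ⟨C, hC, D, hD, hdev⟩ := exists_measure_pi_wassersteinDist_ge_le m hq0 hq1 hqm hR
  set R := |Δ| + 1
  -- `K` is large enough that the second term of the radius absorbs the mean deviation, and `c₁` is
  -- large enough that the first term absorbs the fluctuation
  set K := 1 + 2 * C with hKdef
  have hK1 : 1 ≤ K := by linarith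
  have hK0 : 0 < K := by linarith
  have hDK : 0 < D * K := by positivity
  refine ⟨4 + 128 * D * K, by positivity, 12 * K ^ 3, by positivity, fun β₀ hβ₀ hβ₀1 => ?_⟩
  set c₁ := 4 + 128 * D * K with hc₁
  have hc₁0 : 0 < c₁ := by positivity
  -- in the large-drift regime the radius exceeds the diameter
  obtain ⟨c₃, hc₃, c₄, hc₄, hc₄0, hlarge⟩ : ∃ c₃ > (0 : ℝ), ∃ c₄ ≥ (0 : ℝ), (β₀ < 1 → c₄ = 0) ∧
      ∀ β : ℝ, 0 < β → β < β₀ → R ≤ c₃ * Real.log (1 / β) ^ (1 / 2 : ℝ) + c₄ := by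
    rcases hβ₀1.lt_or_eq with h | h
    · have hL₀ : 0 < Real.log (1 / β₀) := Real.log_pos (by rw [lt_div_iff₀ hβ₀]; linarith)
      refine ⟨R / Real.log (1 / β₀) ^ (1 / 2 : ℝ), by positivity, 0, le_rfl, fun _ => rfl,
        fun β hβ hββ₀ => ?_⟩
      rw [add_zero, div_mul_eq_mul_div, le_div_iff₀ (by positivity)]
      gcongr
    · refine ⟨1, one_pos, R, hR.le, fun h' => absurd h h'.ne, fun β hβ hββ₀ => ?_⟩
      have : 0 ≤ Real.log (1 / β) ^ (1 / 2 : ℝ) :=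
        Real.rpow_nonneg (Real.log_nonneg (by rw [le_div_iff₀ hβ]; linarith)) _
      linarith
  refine ⟨c₃, hc₃, c₄, hc₄, hc₄0, fun Ξ hclosed hbdd hdiam β hβ hββ₀ ρ hρ T hT => ?_⟩
  have hL : 0 < Real.log (1 / β) := Real.log_pos (by rw [lt_div_iff₀ hβ]; linarith)
  set L := Real.log (1 / β) with hLdef
  set N := (12 / (12 * K ^ 3) * ρ ^ (-2 : ℝ) * L) ^ (1 / 3 : ℝ) with hN
  obtain ⟨hN0, hNL, hterm₁, hterm₂⟩ := confidenceRadius_terms_eq (q := q) hK0 hL hρ hN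
  have hT0 : 0 < T := by exact_mod_cast hN0.trans_le hT
  have hdist : ∀ x y : Ξ, dist x y < R := fun x y =>
    ((Metric.dist_le_diam_of_mem hbdd x.2 y.2).trans (hdiam.trans (le_abs_self Δ))).trans_lt
      (lt_add_one _)
  have hsmall : ρ < driftThreshold (12 * K ^ 3) β → 1 < N :=
    one_lt_of_lt_driftThreshold hK0 hL hρ
  set ε := confidenceRadius c₁ (12 * K ^ 3) c₃ c₄ q β ρ with hεdef
  have hεsmall : ρ < driftThreshold (12 * K ^ 3) β →
      ε = c₁ * (K * N * ρ) + 12 * K ^ 3 * (K ^ (-q) * N ^ (-q)) := fun h => by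
    rw [hεdef, confidenceRadius, if_pos h, hterm₁, hterm₂]
  have hεlarge : ¬ ρ < driftThreshold (12 * K ^ 3) β → R + ρ ≤ ε := fun h => by
    rw [hεdef, confidenceRadius, if_neg h]
    linarith [hlarge β hβ hββ₀]
  have hεN : ρ < driftThreshold (12 * K ^ 3) β → 2 * ρ * (N + 1) ≤ ε := fun h => by
    have h1 := hsmall h
    have h2 : 4 * (N * ρ) ≤ c₁ * (K * N * ρ) := by
      have : 4 ≤ c₁ * K := by nlinarith
      calc 4 * (N * ρ) ≤ c₁ * K * (N * ρ) := by gcongr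
        _ = c₁ * (K * N * ρ) := by ring
    have h3 : 0 < 12 * K ^ 3 * (K ^ (-q) * N ^ (-q)) := by positivity
    have h4 : ρ ≤ N * ρ := le_mul_of_one_le_left hρ.le h1.le
    rw [hεsmall h]
    linarith
  have hρε : ρ < ε := by
    by_cases h : ρ < driftThreshold (12 * K ^ 3) β
    · have := hεN h
      have : 0 < ρ * N := by positivity
      linarith
    · linarith [hεlarge h]
  refine ⟨⟨_, isOptimalWeighting_triangularWeights hT0 hρε⟩, fun w hw => ?_⟩
  have hweq := hw.eq_triangularWeights hT0 hρε
  refine ⟨hweq, fun P hP hdrift Ω _ μ _ ξ hind hlaw => ?_⟩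
  have hws := hw.1
  have : Nonempty Ξ := nonempty_of_isProbabilityMeasure (P 0)
  have : StandardBorelSpace Ξ := hclosed.measurableSet.standardBorel
  by_cases hreg : ρ < driftThreshold (12 * K ^ 3) β
  swap
  · have hempty : {ω | ENNReal.ofReal ε ≤
        wassersteinDist 1 (weightedEmpirical w (fun t => ξ t ω)) (P (Fin.last T))} = ∅ := by
      refine Set.eq_empty_of_forall_notMem fun ω hω => ?_
      have := isProbabilityMeasure_weightedEmpirical hws fun t => ξ t ω
      have hle := hω.trans (wassersteinDist_one_le_of_edist_le (d := ENNReal.ofReal R)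
        (fun x y => by rw [edist_dist]; exact ENNReal.ofReal_le_ofReal (hdist x y).le) _ _)
      have := (ENNReal.ofReal_le_ofReal_iff hR.le).1 hle
      linarith [hεlarge hreg]
    rw [hempty, measure_empty]
    exact bot_le
  obtain ⟨hb₁, hb₂⟩ := triangularWeights_bounds hρ hN0 hT (hεN hreg)
  rw [← hweq] at hb₁ hb₂
  have hS0 := sum_sq_pos_of_mem_stdSimplex hws
  set S := ∑ t, w t ^ 2 with hS
  set d := weightedDrift 1 w * ρ with hd
  have hmean := mul_rpow_le_second_term hq0 hq1 hC hKdef hN0 hS0 hb₁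
  set s := ε - d - C * S ^ q with hs
  have hslow : c₁ * (K * N * ρ) / 8 ≤ s := by
    have := hεsmall hreg
    linarith
  have hs0 : 0 ≤ s := le_trans (by positivity) hslow
  have htail : L * (D * S) ≤ s ^ 2 :=
    (mul_le_sq_first_term hD hK0 hN0 hρ hb₁ hc₁ hNL).trans (by gcongr)
  have hexp : Real.exp (-s ^ 2 / (D * S)) ≤ β :=
    calc Real.exp (-s ^ 2 / (D * S)) ≤ Real.exp (-L) := by
          refine Real.exp_le_exp.2 ?_
          rw [div_le_iff₀ (by positivity)]
          linarith
      _ = β := by rw [hLdef, one_div, Real.log_inv, neg_neg, Real.exp_log hβ]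
  have hdev' := hdev Ξ hdist T w hws (fun t => P t.castSucc) (fun t => hP _) s hs0
  have hsplit : ε = C * S ^ q + s + d := by rw [hs]; ring
  rw [hsplit]
  exact (measure_wassersteinDist_last_ge_le hP hρ.le hdrift hws hind hlaw (by positivity)).trans
    (hdev'.trans (ENNReal.ofReal_le_ofReal hexp))
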